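/- Let $l$ be a prime number and let $K$ be a finite extension of $\mathbf{Q}_l$ which contains a primitive $l$-th root of unity $\zeta$. Let $\mathfrak o$ be its ring of integers, $\mathfrak p$ its maximal ideal, $k=\mathfrak o/\mathfrak p$, $v_K$ the normalised valuation, $e=v_K(l)$ and $e_1=e/(l-1)$ (an integer, since $\zeta\in K$). Put $U_n=\ker(\mathfrak o^\times\to(\mathfrak o/\mathfrak p^n)^\times)$, let $\bar U_n$ be the image of $U_n$ in the $\mathbf F_l$-space $K^\times/K^{\times l}$, write $\bar\mu$ for the class of $\mu\in K^\times$ there, and let $\wp:k\to k$ be $x\mapsto x^l-x$. A uniformiser of a finite extension of $\mathbf{Q}_l$ is a generator of the maximal ideal of its ring of integers. Let $D\subset K^\times/K^{\times l}$ be an $\mathbf F_l$-line, let $L=K(\sqrt[l]{D})$ (inside an algebraic closure of $K$), and let $\mathfrak o_L$ be the ring of integers of $L$. Then $\mathfrak o_L=\mathfrak o[\alpha]$ for some $\alpha\in L$. Moreover, $D$ falls under one of the following three cases: $D\not\subset\bar U_1$; or $D\subset\bar U_1$ and there is an $m<le_1$ with $D\subset\bar U_m$, $D\not\subset\bar U_{m+1}$;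 or $D=\bar U_{le_1}$. In these cases, the following holds. (1) If $D\not\subset\bar U_1$, there is a uniformiser $\mu$ of $K$ with $\bar\mu\in D$. For every such $\mu$ and every $l$-th root $\sqrt[l]{\mu}$ of $\mu$ in $L$, the element $\sqrt[l]{\mu}$ is a uniformiser of $L$ and $\mathfrak o_L=\mathfrak o[\sqrt[l]{\mu}]$. (2) Suppose that $D\subset\bar U_1$, let $\mu\in\mathfrak o^\times$ be any unit such that $\bar\mu$ generates $D$, and let $m<le_1$ be such that $\bar\mu\in\bar U_m$ but $\bar\mu\notin\bar U_{m+1}$. Then $m$ is prime to $l$, and there is a unit $\xi\in\mathfrak o^\times$ with $v_K(\xi^l-\mu)=m$. For every such $\xi$, every $l$-th root $\sqrt[l]{\mu}$ of $\mu$ in $L$, every uniformiser $\lambda$ of $K$ and all $x,y\in\mathbf Z$ with $mx+ly=1$, the element $\Lambda=(\xi-\sqrt[l]{\mu})^x\lambda^y$ is a uniformiser of $L$ and $\mathfrak o_L=\mathfrak o[\Lambda]$. (3) If $D=\bar U_{le_1}$, then every uniformiser $\lambda$ of $K$ remains a uniformiser of $L$. For every $\eta\in\mathfrak o$ whose image generates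 $k/\wp(k)$, the element $\mu=1-\eta\, l(1-\zeta)$ is a unit of $\mathfrak o$ whose class generates $D$, and $\mathfrak o_L=\mathfrak o[(\sqrt[l]{\mu}-1)/(1-\zeta)]$ for every $l$-th root $\sqrt[l]{\mu}$ of $\mu$ in $L$. -/

import Mathlib

namespace LocalKummer

noncomputable section

variable (p : ℕ) [Fact p.Prime] (F : Type*) [Field F] [Algebra ℚ_[p] F]

/-- The ring of integers of an algebraic extension `F` of `ℚ_p`: the integral closure in `F` of
the ring of `p`-adic integers (seen as a subring of `ℚ_p`). -/
abbrev ringOfIntegers : Subalgebra (PadicInt.subring p) F :=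
  integralClosure (PadicInt.subring p) F

/-- For `F` finite over `ℚ_p`, the ring of integers is the unit ball of the absolute value of `F`
extending the one of `ℚ_p`. -/
theorem mem_ringOfIntegers_iff_spectralNorm_le_one [FiniteDimensional ℚ_[p] F] (x : F) :
    x ∈ ringOfIntegers p F ↔ spectralNorm ℚ_[p] F x ≤ 1 := by
  constructor
  · rintro ⟨f, hf, hfx⟩
    let _ := spectralNorm.nontriviallyNormedField ℚ_[p] F
    let _ := spectralNorm.normedAlgebra ℚ_[p] F
    have : IsUltrametricDist F :=
      IsUltrametricDist.isUltrametricDist_of_isNonarchimedean_norm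
        (isNonarchimedean_spectralNorm (K := ℚ_[p]) (L := F))
    let φ : PadicInt.subring p →+* (NormedField.valuation (K := F)).integer :=
      { toFun := fun a => ⟨algebraMap ℚ_[p] F a, by
          have h : ‖algebraMap ℚ_[p] F a‖ ≤ 1 := by
            rw [norm_algebraMap']
            exact a.2
          exact h⟩
        map_one' := by ext; simp
        map_mul' := fun a b => by ext; simp
        map_zero' := by ext; simp
        map_add' := fun a b => by ext; simp }
    have hx : IsIntegral (NormedField.valuation (K := F)).integer x := by
      refine ⟨f.map φ, hf.map φ, ?_⟩
      rw [Polynomial.eval₂_map]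
      exact hfx
    have := ((Valuation.integer.integers
      (NormedField.valuation (K := F))).isIntegral_iff_v_le_one).1 hx
    exact this
  · intro h
    have hx : IsIntegral ℚ_[p] x := Algebra.IsIntegral.isIntegral x
    have hc := (spectralValue_le_one_iff (minpoly.monic hx)).1 h
    have hsub : (↑(minpoly ℚ_[p] x).coeffs : Set ℚ_[p]) ⊆ PadicInt.subring p := by
      intro c hc'
      obtain ⟨n, -, rfl⟩ := Polynomial.mem_coeffs_iff.1 (Finset.mem_coe.1 hc')
      exact hc n
    refine ⟨(minpoly ℚ_[p] x).toSubring _ hsub,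
      (Polynomial.monic_toSubring _ _ hsub).2 (minpoly.monic hx), ?_⟩
    have h2 := minpoly.aeval ℚ_[p] x
    rw [← Polynomial.map_toSubring (minpoly ℚ_[p] x) (PadicInt.subring p) hsub,
      Polynomial.aeval_def, Polynomial.eval₂_map] at h2
    exact h2

instance isDiscreteValuationRing_ringOfIntegers [FiniteDimensional ℚ_[p] F] :
    IsDiscreteValuationRing (ringOfIntegers p F) := by
  let _ := spectralNorm.nontriviallyNormedField ℚ_[p] F
  let _ := spectralNorm.normedAlgebra ℚ_[p] F
  have : IsUltrametricDist F :=
    IsUltrametricDist.isUltrametricDist_of_isNonarchimedean_norm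
      (isNonarchimedean_spectralNorm (K := ℚ_[p]) (L := F))
  have : ProperSpace F := FiniteDimensional.proper ℚ_[p] F
  let _ : Valued F NNReal := NormedField.toValued
  have : CompactSpace (Valued.integer F) := by
    have h : ((Valued.integer F : Subring F) : Set F) = Metric.closedBall (0 : F) 1 := by
      ext x
      rw [mem_closedBall_zero_iff]
      exact Iff.rfl
    refine isCompact_iff_compactSpace.mp (?_ : IsCompact ((Valued.integer F : Subring F) : Set F))
    rw [h]
    exact isCompact_closedBall (0 : F) 1
  have : (Valued.v : Valuation F NNReal).IsNontrivial := by
    obtain ⟨x, hx⟩ := NontriviallyNormedField.non_trivial (α := F)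
    have hx' : (1 : NNReal) < Valued.v x := hx
    exact ⟨x, (zero_lt_one.trans hx').ne', hx'.ne'⟩
  have : IsDiscreteValuationRing (Valued.integer F) :=
    Valued.integer.isDiscreteValuationRing_of_compactSpace
  have hset : Valued.integer F = (ringOfIntegers p F).toSubring := by
    ext x
    exact (mem_ringOfIntegers_iff_spectralNorm_le_one p F x).symm
  exact IsDiscreteValuationRing.RingEquivClass.isDiscreteValuationRing (RingEquiv.subringCongr hset)

/-- The prime `p`, as an element of the ring of integers, is not a unit. -/
theorem natCast_mem_maximalIdeal [FiniteDimensional ℚ_[p] F] :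
    (p : ringOfIntegers p F) ∈ IsLocalRing.maximalIdeal (ringOfIntegers p F) := by
  rw [IsLocalRing.mem_maximalIdeal, mem_nonunits_iff]
  rintro h
  obtain ⟨b, hb⟩ := h.exists_right_inv
  have hp0 : (p : ℚ_[p]) ≠ 0 := by exact_mod_cast (Fact.out : p.Prime).ne_zero
  have hbF : (b : F) = algebraMap ℚ_[p] F (p : ℚ_[p])⁻¹ := by
    have h1 : (p : F) * (b : F) = 1 := by
      have := congrArg (Subtype.val) hb
      simpa using this
    rw [map_inv₀, map_natCast]
    exact eq_inv_of_mul_eq_one_right h1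
  have h2 := (mem_ringOfIntegers_iff_spectralNorm_le_one p F (b : F)).1 b.2
  rw [hbF, spectralNorm_extends, norm_inv, Padic.norm_p, inv_inv] at h2
  have h3 : (1 : ℝ) < p := by exact_mod_cast (Fact.out : p.Prime).one_lt
  linarith

/-- The maximal ideal `𝔭` of the ring of integers. -/
abbrev maxIdeal [FiniteDimensional ℚ_[p] F] : Ideal (ringOfIntegers p F) :=
  IsLocalRing.maximalIdeal (ringOfIntegers p F)

/-- The residue field `k`. -/
abbrev residueField [FiniteDimensional ℚ_[p] F] : Type _ :=
  IsLocalRing.ResidueField (ringOfIntegers p F)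

instance charP_residueField [FiniteDimensional ℚ_[p] F] : CharP (residueField p F) p := by
  refine (CharP.charP_iff_prime_eq_zero (Fact.out : p.Prime)).2 ?_
  have h := (IsLocalRing.residue_eq_zero_iff _).2 (natCast_mem_maximalIdeal p F)
  rwa [map_natCast] at h

/-- `x` is a uniformiser of `F`: it lies in the ring of integers and generates its (unique)
maximal ideal. -/
def IsUniformiser (x : F) : Prop :=
  ∃ a : ringOfIntegers p F, (a : F) = x ∧
    ∀ I : Ideal (ringOfIntegers p F), I.IsMaximal ↔ I = Ideal.span {a}

/-- The normalised valuation on the ring of integers (with value `⊤` at `0`). -/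
abbrev normVal [FiniteDimensional ℚ_[p] F] (x : ringOfIntegers p F) : ℕ∞ :=
  IsDiscreteValuationRing.addVal (ringOfIntegers p F) x

/-- The absolute ramification index `e` of `F`, that is the normalised valuation of `p`. -/
def absRamIdx [FiniteDimensional ℚ_[p] F] : ℕ :=
  (normVal p F p).toNat

/-- `e₁ = e / (p - 1)`; the division is exact as soon as `F` contains a primitive `p`-th root
of unity. -/
def ramOne [FiniteDimensional ℚ_[p] F] : ℕ :=
  absRamIdx p F / (p - 1)

/-- A unit of the ring of integers, as an element of the multiplicative group of `F`. -/
abbrev unitToField : (ringOfIntegers p F)ˣ →* Fˣ :=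
  Units.map (algebraMap (ringOfIntegers p F) F : ringOfIntegers p F →* F)

/-- The filtration by units: `U_n` is the kernel of `𝔬ˣ → (𝔬 / 𝔭 ^ n)ˣ`, as a subgroup of `Fˣ`. So
`U_0 = 𝔬ˣ` and `U_n = 1 + 𝔭 ^ n` for `n > 0`. -/
def unitFiltration [FiniteDimensional ℚ_[p] F] (n : ℕ) : Subgroup Fˣ :=
  (Units.map (Ideal.Quotient.mk (maxIdeal p F ^ n) :
    ringOfIntegers p F →* ringOfIntegers p F ⧸ maxIdeal p F ^ n)).ker.map (unitToField p F)

/-- The group `Fˣ / Fˣᵖ`. -/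
abbrev PowerClasses (p : ℕ) (F : Type*) [Field F] : Type _ :=
  Fˣ ⧸ (powMonoidHom p : Fˣ →* Fˣ).range

/-- The class in `Fˣ / Fˣᵖ` of an element of `Fˣ`. -/
abbrev powerClass (p : ℕ) {F : Type*} [Field F] : Fˣ →* PowerClasses p F :=
  QuotientGroup.mk' _

/-- The induced filtration `Ū_n` on `Fˣ / Fˣᵖ`: the image of `U_n`. -/
def classFiltration [FiniteDimensional ℚ_[p] F] (n : ℕ) : Subgroup (PowerClasses p F) :=
  (unitFiltration p F n).map (powerClass p)

/-- A line of the `𝔽_p`-space `Fˣ / Fˣᵖ`: the subspaces of dimension one are the subgroups with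
`p` elements. -/
def IsLine {p : ℕ} {F : Type*} [Field F] (D : Subgroup (PowerClasses p F)) : Prop :=
  Nat.card D = p

/-- The extension `F(D^{1/p})`, inside an algebraic closure of `F`, obtained by adjoining all the
`p`-th roots of all the elements of `Fˣ` whose class lies in `D`. -/
def kummerExtension {p : ℕ} {F : Type*} [Field F] (D : Subgroup (PowerClasses p F)) :
    IntermediateField F (AlgebraicClosure F) :=
  IntermediateField.adjoin F
    {x | ∃ a : Fˣ, powerClass p a ∈ D ∧ x ^ p = algebraMap F (AlgebraicClosure F) a}

/-- The additive map `℘ : x ↦ x ^ p - x` on a field of characteristic `p`. -/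
def artinSchreier (k : Type*) [Field k] [CharP k p] : k →+ k :=
  (frobenius k p).toAddMonoidHom - AddMonoidHom.id k

/-- The element `c` has an image generating `k / ℘(k)`. -/
def GeneratesArtinSchreier (k : Type*) [Field k] [CharP k p] (c : k) : Prop :=
  AddSubgroup.zmultiples (QuotientAddGroup.mk c : k ⧸ (artinSchreier p k).range) = ⊤

/-- For an extension `L` of `F`: the ring of integers of `L` is generated by `α` as an algebra over
the ring of integers of `F`, that is, `𝔬_L = 𝔬[α]`. -/
def IsIntegralGenerator (L : Type*) [Field L] [Algebra ℚ_[p] L] [Algebra F L] (α : L) : Prop :=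
  (ringOfIntegers p L : Set L) = Algebra.adjoin (ringOfIntegers p F) {α}

end

end LocalKummer

open LocalKummer

/-! Everything is read off the absolute value, written `|·|` below, that extends the one of `ℚ_l`.
Write `L = K(ρ)` with `ρ ^ l = μ`, of degree `l`. The conjugates `ξ - zρ` of `ξ - ρ` have the same
absolute value and their product is `ξ ^ l - μ`, so `|ξ - ρ| ^ l = |ξ ^ l - μ|`
(`spectralValuation_sub_root_pow`).

Ramified cases: from a uniformiser `μ`, or from `|ξ ^ l - μ| = |π| ^ m` with `m` prime to `l` and
Bézout, one gets `A` in `L` with `|A| ^ l = |π|`. The powers `1, A, …, A ^ (l - 1)` have absolute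
values in distinct cosets of the value group of `K`. Hence a `K`-combination of them is as large as
its largest term (`hasOrthogonalPowers_of_pow_eq`), which gives both the uniformiser and `𝔬_L =
𝔬[A]`. That `m` is prime to `l` holds because `1 + π ^ (l s) c` with `0 < s < e₁` can be improved by
the factor `(1 + d π ^ s) ^ l`, where `d ^ l ≡ c` (`powerClass_mem_classFiltration_succ`).

Deepest level: `l ≡ -(1 - ζ) ^ (l - 1)` up to a principal unit, so `(1 + (1 - ζ) b) ^ l` is `1 + (1
- ζ) ^ l (b ^ l - b)` to first order. With a Hensel argument, `1 - a l (1 - ζ)` is an `l`-th power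
once `a` reduces into `℘(k)`. As `k / ℘(k)` has order `l`, one class generates `Ū_{l e₁}`
(`classFiltration_eq_zpowers`). The conjugates of `(ρ - 1) / (1 - ζ)` have `l` distinct residues,
and a polynomial of degree less than `l` over the residue field cannot vanish at all of them. So its
powers are orthogonal too, now with absolute value `1`: the extension is unramified. -/

namespace LocalKummer

noncomputable section

open Polynomial IsLocalRing
open scoped NNReal

/-! ### The absolute value and its dictionary with ideals, units and uniformisers. -/

section SpectralValuation

variable (p : ℕ) [Fact p.Prime] (F : Type*) [Field F] [Algebra ℚ_[p] F]

/-- The absolute value of an algebraic extension of `ℚ_p` extending the one of `ℚ_p`, as a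
valuation. -/
def spectralValuation [Algebra.IsAlgebraic ℚ_[p] F] : Valuation F ℝ≥0 :=
  letI := spectralNorm.nontriviallyNormedField ℚ_[p] F
  haveI : IsUltrametricDist F :=
    IsUltrametricDist.isUltrametricDist_of_isNonarchimedean_norm
      (isNonarchimedean_spectralNorm (K := ℚ_[p]) (L := F))
  NormedField.valuation

variable {F}

theorem coe_spectralValuation [Algebra.IsAlgebraic ℚ_[p] F] (x : F) :
    (spectralValuation p F x : ℝ) = spectralNorm ℚ_[p] F x := rfl

theorem spectralValuation_eq_of_minpoly_eq {L : Type*} [Field L] [Algebra ℚ_[p] L]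
    [Algebra.IsAlgebraic ℚ_[p] F] [Algebra.IsAlgebraic ℚ_[p] L] {x : F} {y : L}
    (h : minpoly ℚ_[p] x = minpoly ℚ_[p] y) :
    spectralValuation p F x = spectralValuation p L y := by
  apply NNReal.coe_injective
  rw [coe_spectralValuation, coe_spectralValuation, spectralNorm, spectralNorm, h]

theorem spectralValuation_algebraMap (L : Type*) [Field L] [Algebra ℚ_[p] L] [Algebra F L]
    [IsScalarTower ℚ_[p] F L]
    [Algebra.IsAlgebraic ℚ_[p] F] [Algebra.IsAlgebraic ℚ_[p] L] (x : F) :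
    spectralValuation p L (algebraMap F L x) = spectralValuation p F x :=
  NNReal.coe_injective (spectralNorm.eq_of_tower x).symm

/-- Conjugate elements have the same absolute value. -/
theorem spectralValuation_aeval_eq {L : Type*} [Field L] [Algebra ℚ_[p] L] [Algebra F L]
    [IsScalarTower ℚ_[p] F L] [Algebra.IsAlgebraic ℚ_[p] F] [Algebra.IsAlgebraic ℚ_[p] L]
    {f : F[X]} (hf : Irreducible f) {ρ ρ' : L} (hρ : aeval ρ f = 0) (hρ' : aeval ρ' f = 0)
    (g : F[X]) :
    spectralValuation p L (aeval ρ g) = spectralValuation p L (aeval ρ' g) := by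
  have := Fact.mk hf
  -- Both values are images of one element of `AdjoinRoot f` under embeddings over `ℚ_p`, so they
  -- share a minimal polynomial; `L` need not be normal over `F`.
  have key : ∀ σ : L, aeval σ f = 0 →
      minpoly ℚ_[p] (aeval σ g) = minpoly ℚ_[p] (AdjoinRoot.mk f g) := by
    intro σ hσ
    let φ : AdjoinRoot f →ₐ[F] L := AdjoinRoot.liftAlgHom f (Algebra.ofId F L) σ hσ
    have h : aeval σ g = φ.restrictScalars ℚ_[p] (AdjoinRoot.mk f g) := by
      simp [φ, Algebra.ofId, aeval_def]
    rw [h]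
    exact minpoly.algHom_eq _ (RingHom.injective _) _
  exact spectralValuation_eq_of_minpoly_eq p ((key ρ hρ).trans (key ρ' hρ').symm)

variable [FiniteDimensional ℚ_[p] F]

theorem mem_ringOfIntegers_iff (x : F) :
    x ∈ ringOfIntegers p F ↔ spectralValuation p F x ≤ 1 :=
  mem_ringOfIntegers_iff_spectralNorm_le_one p F x

theorem spectralValuation_coe_le_one (x : ringOfIntegers p F) :
    spectralValuation p F (x : F) ≤ 1 :=
  (mem_ringOfIntegers_iff p _).1 x.2

theorem dvd_iff_spectralValuation_le (a b : ringOfIntegers p F) :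
    a ∣ b ↔ spectralValuation p F (b : F) ≤ spectralValuation p F (a : F) := by
  constructor
  · rintro ⟨c, rfl⟩
    push_cast
    rw [map_mul]
    exact mul_le_of_le_one_right' (spectralValuation_coe_le_one p c)
  · intro h
    by_cases ha : (a : F) = 0
    · have hb : (b : F) = 0 := by
        rw [ha, map_zero, nonpos_iff_eq_zero] at h
        simpa using h
      have : b = 0 := Subtype.ext hb
      simp [this]
    · have hv : spectralValuation p F (a : F) ≠ 0 := by simpa using ha
      refine ⟨⟨(b : F) / a, (mem_ringOfIntegers_iff p _).2 ?_⟩, ?_⟩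
      · rw [map_div₀]
        exact div_le_one_of_le₀ h (zero_le)
      · ext
        push_cast
        field_simp

theorem isUnit_iff_spectralValuation_eq_one (a : ringOfIntegers p F) :
    IsUnit a ↔ spectralValuation p F (a : F) = 1 := by
  rw [isUnit_iff_dvd_one, dvd_iff_spectralValuation_le]
  push_cast
  rw [map_one]
  exact ⟨fun h => le_antisymm (spectralValuation_coe_le_one p a) h, fun h => h.ge⟩

theorem spectralValuation_unit (u : (ringOfIntegers p F)ˣ) :
    spectralValuation p F ((u : ringOfIntegers p F) : F) = 1 :=
  (isUnit_iff_spectralValuation_eq_one p _).1 u.isUnit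

theorem mem_maxIdeal_iff (a : ringOfIntegers p F) :
    a ∈ maxIdeal p F ↔ spectralValuation p F (a : F) < 1 := by
  rw [IsLocalRing.mem_maximalIdeal, mem_nonunits_iff, isUnit_iff_spectralValuation_eq_one]
  exact ⟨fun h => lt_of_le_of_ne (spectralValuation_coe_le_one p a) h, fun h => h.ne⟩

variable {p}

theorem spectralValuation_irreducible_lt_one {π : ringOfIntegers p F} (hπ : Irreducible π) :
    spectralValuation p F (π : F) < 1 := by
  rw [← mem_maxIdeal_iff]
  exact hπ.not_isUnit

theorem spectralValuation_irreducible_pos {π : ringOfIntegers p F} (hπ : Irreducible π) :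
    0 < spectralValuation p F (π : F) := by
  rw [zero_lt_iff, Valuation.ne_zero_iff]
  exact fun h => hπ.ne_zero (Subtype.ext h)

theorem mem_maxIdeal_pow_iff {π : ringOfIntegers p F} (hπ : Irreducible π) (n : ℕ)
    (a : ringOfIntegers p F) :
    a ∈ maxIdeal p F ^ n ↔ spectralValuation p F (a : F) ≤ spectralValuation p F (π : F) ^ n := by
  rw [maxIdeal, hπ.maximalIdeal_eq, Ideal.span_singleton_pow, Ideal.mem_span_singleton,
    dvd_iff_spectralValuation_le]
  push_cast
  rw [map_pow]

theorem normVal_eq_iff {π : ringOfIntegers p F} (hπ : Irreducible π) (n : ℕ)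
    (a : ringOfIntegers p F) :
    normVal p F a = n ↔ spectralValuation p F (a : F) = spectralValuation p F (π : F) ^ n := by
  rw [← hπ.addVal_pow, normVal, le_antisymm_iff, le_antisymm_iff,
    IsDiscreteValuationRing.addVal_le_iff_dvd, IsDiscreteValuationRing.addVal_le_iff_dvd,
    dvd_iff_spectralValuation_le, dvd_iff_spectralValuation_le]
  push_cast
  rw [map_pow, and_comm]

theorem exists_spectralValuation_eq_zpow {π : ringOfIntegers p F} (hπ : Irreducible π) {x : F}
    (hx : x ≠ 0) : ∃ n : ℤ, spectralValuation p F x = spectralValuation p F (π : F) ^ n := by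
  have key : ∀ a : ringOfIntegers p F, a ≠ 0 →
      ∃ n : ℕ, spectralValuation p F (a : F) = spectralValuation p F (π : F) ^ n := by
    intro a ha
    obtain ⟨n, hn⟩ := ENat.ne_top_iff_exists.1
      (mt IsDiscreteValuationRing.addVal_eq_top_iff.1 ha)
    exact ⟨n, (normVal_eq_iff hπ n a).1 hn.symm⟩
  by_cases h : spectralValuation p F x ≤ 1
  · obtain ⟨n, hn⟩ := key ⟨x, (mem_ringOfIntegers_iff p x).2 h⟩
      (fun h0 => hx (congrArg Subtype.val h0))
    exact ⟨n, by simpa using hn⟩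
  · have h' : spectralValuation p F x⁻¹ ≤ 1 := by
      rw [map_inv₀]
      exact inv_le_one_of_one_le₀ (not_le.1 h).le
    obtain ⟨n, hn⟩ := key ⟨x⁻¹, (mem_ringOfIntegers_iff p _).2 h'⟩
      (fun h0 => hx (inv_eq_zero.1 (congrArg Subtype.val h0)))
    refine ⟨-n, ?_⟩
    rw [map_inv₀] at hn
    rw [zpow_neg, zpow_natCast, ← hn, inv_inv]

theorem spectralValuation_le_of_lt_one {π : ringOfIntegers p F} (hπ : Irreducible π) {x : F}
    (hx : spectralValuation p F x < 1) :
    spectralValuation p F x ≤ spectralValuation p F (π : F) := by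
  have h := (mem_maxIdeal_iff p ⟨x, (mem_ringOfIntegers_iff p x).2 hx.le⟩).2 hx
  rw [← pow_one (maxIdeal p F), mem_maxIdeal_pow_iff hπ, pow_one] at h
  exact h

/-- The value group is discrete: after division by `π ^ n`, an element of value less than `1` has
value at most `|π|`. -/
theorem spectralValuation_le_pow_succ {π : ringOfIntegers p F} (hπ : Irreducible π) {x : F}
    {n : ℕ} (hx : spectralValuation p F x < spectralValuation p F (π : F) ^ n) :
    spectralValuation p F x ≤ spectralValuation p F (π : F) ^ (n + 1) := by
  have hq := spectralValuation_irreducible_pos hπ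
  have h : spectralValuation p F (x / (π : F) ^ n) < 1 := by
    rw [map_div₀, map_pow]
    exact (div_lt_one₀ (pow_pos hq n)).2 hx
  have := spectralValuation_le_of_lt_one hπ h
  rw [map_div₀, map_pow, div_le_iff₀ (pow_pos hq n)] at this
  rwa [pow_succ']

theorem isUniformiser_of_spectralValuation {x : F} (hx : spectralValuation p F x < 1)
    (h : ∀ y : F, spectralValuation p F y < 1 → spectralValuation p F y ≤ spectralValuation p F x) :
    IsUniformiser p F x := by
  refine ⟨⟨x, (mem_ringOfIntegers_iff p x).2 hx.le⟩, rfl, fun I => ?_⟩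
  have hspan : maxIdeal p F = Ideal.span {⟨x, (mem_ringOfIntegers_iff p x).2 hx.le⟩} := by
    ext a
    rw [Ideal.mem_span_singleton, mem_maxIdeal_iff, dvd_iff_spectralValuation_le]
    exact ⟨h a, fun h' => h'.trans_lt hx⟩
  rw [← hspan]
  exact ⟨fun hI => IsLocalRing.eq_maximalIdeal hI, fun hI => hI ▸ inferInstance⟩

theorem IsUniformiser.exists_irreducible {x : F} (hx : IsUniformiser p F x) :
    ∃ π : ringOfIntegers p F, (π : F) = x ∧ Irreducible π := by
  obtain ⟨a, rfl, ha⟩ := hx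
  refine ⟨a, rfl, ?_⟩
  rw [IsDiscreteValuationRing.irreducible_iff_uniformizer]
  exact (ha _).1 inferInstance

theorem isUniformiser_iff {π : ringOfIntegers p F} (hπ : Irreducible π) {x : F} :
    IsUniformiser p F x ↔ spectralValuation p F x = spectralValuation p F (π : F) := by
  constructor
  · intro hx
    obtain ⟨a, rfl, ha⟩ := hx.exists_irreducible
    exact le_antisymm
      (spectralValuation_le_of_lt_one hπ (spectralValuation_irreducible_lt_one ha))
      (spectralValuation_le_of_lt_one ha (spectralValuation_irreducible_lt_one hπ))
  · intro hx
    apply isUniformiser_of_spectralValuation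
    · rw [hx]
      exact spectralValuation_irreducible_lt_one hπ
    · intro y hy
      rw [hx]
      exact spectralValuation_le_of_lt_one hπ hy

-- The unit ball is compact because `F` is locally compact. Finiteness serves twice: Frobenius is
-- bijective on `k`, and `℘` has a cokernel as large as its kernel.
variable (p F) in
instance finite_residueField : Finite (residueField p F) := by
  let _ := spectralNorm.nontriviallyNormedField ℚ_[p] F
  let _ := spectralNorm.normedAlgebra ℚ_[p] F
  have : IsUltrametricDist F :=
    IsUltrametricDist.isUltrametricDist_of_isNonarchimedean_norm
      (isNonarchimedean_spectralNorm (K := ℚ_[p]) (L := F))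
  have : ProperSpace F := FiniteDimensional.proper ℚ_[p] F
  let _ : Valued F NNReal := NormedField.toValued
  have : CompactSpace (Valued.integer F) := by
    have h : ((Valued.integer F : Subring F) : Set F) = Metric.closedBall (0 : F) 1 := by
      ext x
      rw [mem_closedBall_zero_iff]
      exact Iff.rfl
    refine isCompact_iff_compactSpace.mp (?_ : IsCompact ((Valued.integer F : Subring F) : Set F))
    rw [h]
    exact isCompact_closedBall (0 : F) 1
  have : (Valued.v : Valuation F NNReal).IsNontrivial := by
    obtain ⟨x, hx⟩ := NontriviallyNormedField.non_trivial (α := F)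
    have hx' : (1 : NNReal) < Valued.v x := hx
    exact ⟨x, (zero_lt_one.trans hx').ne', hx'.ne'⟩
  let _ : (Valued.v : Valuation F NNReal).RankOne :=
    (Valuation.nonempty_rankOne_iff_mulArchimedean.2 inferInstance).some
  have hfin : Finite (Valued.ResidueField F) :=
    (Valued.integer.compactSpace_iff_completeSpace_and_isDiscreteValuationRing_and_finite_residueField.1
      inferInstance).2.2
  have hset : Valued.integer F = (ringOfIntegers p F).toSubring := by
    ext x
    exact (mem_ringOfIntegers_iff_spectralNorm_le_one p F x).symm
  let e : Valued.integer F ≃+* ringOfIntegers p F := RingEquiv.subringCongr hset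
  exact Finite.of_equiv _ (IsLocalRing.ResidueField.mapEquiv e).toEquiv

end SpectralValuation

/-! ### Powers of principal units, and `p` in terms of `1 - ζ`. -/

section CyclotomicUniformiser

variable {p : ℕ} [Fact p.Prime] {R : Type*} [CommRing R] [IsLocalRing R]

/-- The binomial expansion of `(1 + x) ^ p`, for `x` in the maximal ideal. -/
theorem exists_one_add_pow_prime_eq {x : R} (hx : x ∈ maximalIdeal R) :
    ∃ s : R, (1 + x) ^ p = 1 + x ^ p + p * x * s ∧ residue R s = 1 := by
  have hp := (Fact.out : p.Prime)
  -- The middle binomial terms divided by `p x`; only `k = 1` survives modulo the maximal ideal.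
  refine ⟨∑ k ∈ Finset.Ioo 0 p, x ^ (k - 1) * 1 ^ (p - k - 1) * ((p.choose k / p : ℕ) : R), ?_, ?_⟩
  · have := add_pow_prime_eq hp x 1
    rw [add_comm 1 x, this]
    ring
  · rw [map_sum, Finset.sum_eq_single 1]
    · simp [Nat.div_self hp.pos]
    · intro k hk hk1
      have : k - 1 ≠ 0 := by
        have := (Finset.mem_Ioo.1 hk).1
        omega
      rw [map_mul, map_mul, map_pow, (residue_eq_zero_iff x).2 hx, zero_pow this, zero_mul,
        zero_mul]
    · intro h
      exact absurd (Finset.mem_Ioo.2 ⟨one_pos, hp.one_lt⟩) h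

variable [CharP (ResidueField R) p] {ζ : R}

theorem residue_primitiveRoot (hζ : IsPrimitiveRoot ζ p) : residue R ζ = 1 := by
  have h : (residue R ζ - 1) ^ p = 0 := by
    rw [sub_pow_char, ← map_pow, hζ.pow_eq_one, map_one, one_pow, sub_self]
  exact sub_eq_zero.1 (eq_zero_of_pow_eq_zero h)

variable [IsDomain R]

/-- The prime `p` is `-(1 - ζ) ^ (p - 1)` up to a principal unit. -/
theorem exists_natCast_prime_eq_pow_mul (hζ : IsPrimitiveRoot ζ p) :
    ∃ c : R, (p : R) = (1 - ζ) ^ (p - 1) * c ∧ residue R c = -1 := by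
  have hp1 : p - 1 + 1 = p := Nat.sub_add_cancel (Fact.out : p.Prime).one_le
  -- The factors are `(1 - ζ ^ (k + 1)) / (1 - ζ)`. Each reduces to `k + 1`, so Wilson's lemma gives
  -- `-1`.
  refine ⟨∏ k ∈ Finset.range (p - 1), ∑ i ∈ Finset.range (k + 1), ζ ^ i, ?_, ?_⟩
  · have h := IsPrimitiveRoot.prod_one_sub_pow_eq_order (n := p - 1) (μ := ζ) (by rwa [hp1])
    have h2 : ((p - 1 : ℕ) : R) + 1 = p := by
      rw [← Nat.cast_add_one, hp1]
    rw [h2] at h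
    rw [← h, ← Finset.card_range (p - 1), ← Finset.prod_const, Finset.card_range,
      ← Finset.prod_mul_distrib]
    refine Finset.prod_congr rfl fun k _ => ?_
    rw [mul_neg_geom_sum]
  · have hfac : ∏ k ∈ Finset.range (p - 1), ((k + 1 : ℕ) : ResidueField R) =
        ((p - 1).factorial : ℕ) := by
      rw [← Finset.prod_range_add_one_eq_factorial, Nat.cast_prod]
    have hw := congrArg (ZMod.castHom (dvd_refl p) (ResidueField R)) (ZMod.wilsons_lemma p)
    rw [map_natCast, map_neg, map_one] at hw
    rw [map_prod, ← hw, ← hfac]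
    refine Finset.prod_congr rfl fun k _ => ?_
    rw [map_sum]
    simp [residue_primitiveRoot hζ]

/-- Modulo `(1 - ζ) ^ p` times the maximal ideal, raising `1 + (1 - ζ) b` to the `p`-th power is
governed by the Artin-Schreier map. -/
theorem exists_one_add_one_sub_mul_pow (hζ : IsPrimitiveRoot ζ p) (b : R) :
    ∃ t : R, (1 + (1 - ζ) * b) ^ p = 1 + (1 - ζ) ^ p * t ∧
      residue R t = residue R b ^ p - residue R b := by
  have hp1 : p - 1 + 1 = p := Nat.sub_add_cancel (Fact.out : p.Prime).one_le
  have h1 : residue R (1 - ζ) = 0 := by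
    rw [map_sub, map_one, residue_primitiveRoot hζ, sub_self]
  obtain ⟨c, hc, hc1⟩ := exists_natCast_prime_eq_pow_mul hζ
  obtain ⟨s, hs, hs1⟩ := exists_one_add_pow_prime_eq (p := p) (x := (1 - ζ) * b)
    ((residue_eq_zero_iff _).1 (by rw [map_mul, h1, zero_mul]))
  -- `b ^ p` comes from `x ^ p`, and `c b s` from `p x s` after replacing `p` by `(1 - ζ) ^ (p - 1)
  -- c`. Since `c ≡ -1` and `s ≡ 1`, the residue is that of `b ^ p - b`.
  refine ⟨b ^ p + c * b * s, ?_, ?_⟩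
  · rw [hs, hc, mul_pow]
    have : (1 - ζ) ^ p = (1 - ζ) ^ (p - 1) * (1 - ζ) := by rw [← pow_succ, hp1]
    rw [this]
    ring
  · rw [map_add, map_mul, map_mul, map_pow, hc1, hs1]
    ring

end CyclotomicUniformiser

/-! ### Conjugates of an `l`-th root. -/

section Conjugates

variable {l : ℕ} [Fact l.Prime] {K L : Type*} [Field K] [Algebra ℚ_[l] K]
  [Algebra.IsAlgebraic ℚ_[l] K] [Field L] [Algebra ℚ_[l] L] [Algebra.IsAlgebraic ℚ_[l] L]
  [Algebra K L] [IsScalarTower ℚ_[l] K L]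

theorem spectralValuation_rootOfUnity {z : K} (hz : z ^ l = 1) : spectralValuation l K z = 1 := by
  have h : spectralValuation l K z ^ l = 1 := by rw [← map_pow, hz, map_one]
  exact (pow_eq_one_iff_of_nonneg zero_le (Fact.out : l.Prime).ne_zero).1 h

/-- The conjugates of `ρ = μ ^ (1 / l)` are its multiples by roots of unity. -/
theorem spectralValuation_aeval_mul_rootOfUnity {μ : K} (hμ : ∀ b : K, b ^ l ≠ μ) {ρ : L}
    (hρ : ρ ^ l = algebraMap K L μ) {z : L} (hz : z ^ l = 1) (g : K[X]) :
    spectralValuation l L (aeval (z * ρ) g) = spectralValuation l L (aeval ρ g) := by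
  refine spectralValuation_aeval_eq l
    (X_pow_sub_C_irreducible_of_prime (Fact.out : l.Prime) hμ) ?_ ?_ g
  · simp [mul_pow, hz, hρ]
  · simp [hρ]

theorem spectralValuation_sub_rootOfUnity_mul {μ : K} (hμ : ∀ b : K, b ^ l ≠ μ) {ρ : L}
    (hρ : ρ ^ l = algebraMap K L μ) {z : L} (hz : z ^ l = 1) (ξ : K) :
    spectralValuation l L (algebraMap K L ξ - z * ρ) =
      spectralValuation l L (algebraMap K L ξ - ρ) := by
  have := spectralValuation_aeval_mul_rootOfUnity hμ hρ hz (C ξ - X)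
  simpa using this

/-- `ξ ^ l - μ` is the product of `ξ - zρ` over the `l` roots of unity `z`, and conjugate factors
have equal absolute value. -/
theorem spectralValuation_sub_root_pow {ζ : K} (hζ : IsPrimitiveRoot ζ l) {μ : K}
    (hμ : ∀ b : K, b ^ l ≠ μ) {ρ : L} (hρ : ρ ^ l = algebraMap K L μ) (ξ : K) :
    spectralValuation l L (algebraMap K L ξ - ρ) ^ l = spectralValuation l K (ξ ^ l - μ) := by
  have hl := (Fact.out : l.Prime)
  have hζ' : IsPrimitiveRoot (algebraMap K L ζ) l := hζ.map_of_injective (algebraMap K L).injective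
  rw [← spectralValuation_algebraMap l L (ξ ^ l - μ), map_sub (algebraMap K L),
    map_pow (algebraMap K L), ← hρ,
    hζ'.pow_sub_pow_eq_prod_sub_mul _ _ hl.pos, map_prod]
  rw [Finset.prod_congr rfl fun z hz => spectralValuation_sub_rootOfUnity_mul hμ hρ
    ((Polynomial.mem_nthRootsFinset hl.pos 1).1 hz) ξ, Finset.prod_const, hζ'.card_nthRootsFinset]

/-- A form of Hensel's lemma. -/
theorem exists_pow_eq_of_spectralValuation_sub_lt {ζ : K} (hζ : IsPrimitiveRoot ζ l) {μ ξ : K}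
    (hμ : spectralValuation l K μ = 1)
    (h : spectralValuation l K (ξ ^ l - μ) < spectralValuation l K (1 - ζ) ^ l) :
    ∃ b : K, b ^ l = μ := by
  have hl := (Fact.out : l.Prime)
  -- As in Krasner's lemma: otherwise `ξ - ρ` and its conjugate `ξ - ζρ` are both smaller than `1 -
  -- ζ`, whereas their difference `(1 - ζ) ρ` up to sign has the same size as `1 - ζ`.
  by_contra! hne
  let Ω := AlgebraicClosure K
  have : Algebra.IsAlgebraic ℚ_[l] Ω := Algebra.IsAlgebraic.trans ℚ_[l] K Ω
  obtain ⟨ρ, hρ⟩ := IsAlgClosed.exists_pow_nat_eq (algebraMap K Ω μ) hl.pos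
  have h1 := spectralValuation_sub_root_pow hζ hne hρ ξ
  rw [← h1] at h
  have h2 := lt_of_pow_lt_pow_left₀ l zero_le h
  have hz : (algebraMap K Ω ζ) ^ l = 1 := by rw [← map_pow, hζ.pow_eq_one, map_one]
  have h3 := spectralValuation_sub_rootOfUnity_mul hne hρ hz ξ
  have hρ1 : spectralValuation l Ω ρ = 1 := by
    have : spectralValuation l Ω ρ ^ l = 1 := by
      rw [← map_pow, hρ, spectralValuation_algebraMap, hμ]
    exact (pow_eq_one_iff_of_nonneg zero_le hl.ne_zero).1 this
  have h4 : spectralValuation l K (1 - ζ) =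
      spectralValuation l Ω
        ((algebraMap K Ω ξ - algebraMap K Ω ζ * ρ) - (algebraMap K Ω ξ - ρ)) := by
    have : (algebraMap K Ω ξ - algebraMap K Ω ζ * ρ) - (algebraMap K Ω ξ - ρ) =
        algebraMap K Ω (1 - ζ) * ρ := by
      rw [map_sub, map_one]
      ring
    rw [this, map_mul, hρ1, mul_one, spectralValuation_algebraMap]
  have h5 := (spectralValuation l Ω).map_sub (algebraMap K Ω ξ - algebraMap K Ω ζ * ρ)
    (algebraMap K Ω ξ - ρ)
  rw [← h4, h3, max_self] at h5
  exact absurd h2 (not_lt.2 h5)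

end Conjugates

/-! ### The absolute values of `l` and `1 - ζ` in terms of `e₁`. -/

section Ramification

variable {l : ℕ} [Fact l.Prime] {K : Type*} [Field K] [Algebra ℚ_[l] K] [FiniteDimensional ℚ_[l] K]

theorem exists_coe_eq_primitiveRoot {ζ : K} (hζ : IsPrimitiveRoot ζ l) :
    ∃ z : ringOfIntegers l K, (z : K) = ζ ∧ IsPrimitiveRoot z l := by
  have hz : ζ ∈ ringOfIntegers l K := by
    rw [mem_ringOfIntegers_iff, spectralValuation_rootOfUnity hζ.pow_eq_one]
  refine ⟨⟨ζ, hz⟩, rfl, IsPrimitiveRoot.of_map_of_injective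
    (f := algebraMap (ringOfIntegers l K) K) hζ Subtype.coe_injective⟩

theorem spectralValuation_natCast_prime {π : ringOfIntegers l K} (hπ : Irreducible π) :
    spectralValuation l K (l : K) = spectralValuation l K (π : K) ^ absRamIdx l K := by
  have h0 : (l : ringOfIntegers l K) ≠ 0 := by
    intro h
    have h' : algebraMap ℚ_[l] K (l : ℚ_[l]) = 0 := by
      rw [map_natCast]
      simpa using congrArg Subtype.val h
    rw [map_eq_zero] at h'
    exact (Fact.out : l.Prime).ne_zero (by exact_mod_cast h')
  have h1 : normVal l K (l : ringOfIntegers l K) = (absRamIdx l K : ℕ∞) :=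
    (ENat.natCast_toNat (mt IsDiscreteValuationRing.addVal_eq_top_iff.1 h0)).symm
  simpa using (normVal_eq_iff hπ _ _).1 h1

theorem spectralValuation_one_sub_primitiveRoot_lt_one {ζ : K} (hζ : IsPrimitiveRoot ζ l) :
    spectralValuation l K (1 - ζ) < 1 := by
  obtain ⟨z, rfl, hz⟩ := exists_coe_eq_primitiveRoot hζ
  have : (1 - z : ringOfIntegers l K) ∈ maxIdeal l K := by
    rw [← residue_eq_zero_iff, map_sub, map_one, residue_primitiveRoot hz, sub_self]
  simpa using (mem_maxIdeal_iff l _).1 this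

theorem spectralValuation_natCast_prime_eq_pow {ζ : K} (hζ : IsPrimitiveRoot ζ l) :
    spectralValuation l K (l : K) = spectralValuation l K (1 - ζ) ^ (l - 1) := by
  obtain ⟨z, rfl, hz⟩ := exists_coe_eq_primitiveRoot hζ
  obtain ⟨c, hc, hc1⟩ := exists_natCast_prime_eq_pow_mul hz
  have hu : IsUnit c := by
    rw [← residue_ne_zero_iff_isUnit, hc1]
    exact neg_ne_zero.2 one_ne_zero
  have h := congrArg (fun a : ringOfIntegers l K => spectralValuation l K (a : K)) hc
  push_cast at h
  rw [map_mul, (isUnit_iff_spectralValuation_eq_one l c).1 hu, mul_one, map_pow] at h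
  exact h

theorem pow_inj_of_irreducible {π : ringOfIntegers l K} (hπ : Irreducible π) {m n : ℕ} :
    spectralValuation l K (π : K) ^ m = spectralValuation l K (π : K) ^ n ↔ m = n :=
  (pow_right_strictAnti₀ (spectralValuation_irreducible_pos hπ)
    (spectralValuation_irreducible_lt_one hπ)).injective.eq_iff

/-- If `n` is the valuation of `1 - ζ`, comparing exponents in `|l| = |1 - ζ| ^ (l - 1)` gives `e =
n (l - 1)`; hence the natural-number division in `ramOne` is exact. -/
theorem spectralValuation_one_sub_primitiveRoot {ζ : K} (hζ : IsPrimitiveRoot ζ l)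
    {π : ringOfIntegers l K} (hπ : Irreducible π) :
    spectralValuation l K (1 - ζ) = spectralValuation l K (π : K) ^ ramOne l K := by
  have hl := (Fact.out : l.Prime)
  obtain ⟨n, hn⟩ : ∃ n : ℕ, spectralValuation l K (1 - ζ) = spectralValuation l K (π : K) ^ n := by
    obtain ⟨z, rfl, hz⟩ := exists_coe_eq_primitiveRoot hζ
    have h0 : (1 - z : ringOfIntegers l K) ≠ 0 := fun h =>
      hz.ne_one hl.one_lt (sub_eq_zero.1 h).symm
    obtain ⟨n, hn⟩ := ENat.ne_top_iff_exists.1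
      (mt IsDiscreteValuationRing.addVal_eq_top_iff.1 h0)
    exact ⟨n, by simpa using (normVal_eq_iff hπ n _).1 hn.symm⟩
  have h1 := spectralValuation_natCast_prime_eq_pow hζ
  rw [spectralValuation_natCast_prime hπ, hn, ← pow_mul, pow_inj_of_irreducible hπ] at h1
  rw [hn, ramOne, h1, Nat.mul_div_cancel _ (Nat.sub_pos_of_lt hl.one_lt)]

theorem spectralValuation_natCast_prime_eq_pow_ramOne {ζ : K} (hζ : IsPrimitiveRoot ζ l)
    {π : ringOfIntegers l K} (hπ : Irreducible π) :
    spectralValuation l K (l : K) = spectralValuation l K (π : K) ^ (ramOne l K * (l - 1)) := by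
  rw [spectralValuation_natCast_prime_eq_pow hζ, spectralValuation_one_sub_primitiveRoot hζ hπ,
    pow_mul]

theorem ramOne_pos {ζ : K} (hζ : IsPrimitiveRoot ζ l) : 0 < ramOne l K := by
  obtain ⟨π, hπ⟩ := IsDiscreteValuationRing.exists_irreducible (ringOfIntegers l K)
  have h := spectralValuation_one_sub_primitiveRoot_lt_one hζ
  rw [spectralValuation_one_sub_primitiveRoot hζ hπ] at h
  by_contra! h0
  rw [Nat.le_zero.1 h0, pow_zero] at h
  exact lt_irrefl _ h

end Ramification

/-! ### The unit filtration modulo `l`-th powers and its jumps. -/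

section ClassFiltration

variable {l : ℕ} {K : Type*} [Field K]

theorem powerClass_eq_one_iff {x : Kˣ} : powerClass l x = 1 ↔ ∃ c : Kˣ, c ^ l = x := by
  rw [QuotientGroup.mk'_apply, QuotientGroup.eq_one_iff]
  rfl

theorem powerClass_eq_iff {x y : Kˣ} :
    powerClass l x = powerClass l y ↔ ∃ c : Kˣ, x = y * c ^ l := by
  rw [eq_comm, ← inv_mul_eq_one, ← map_inv, ← map_mul, powerClass_eq_one_iff]
  exact exists_congr fun c => by rw [eq_inv_mul_iff_mul_eq, eq_comm]

theorem powerClass_pow_eq_one (d : PowerClasses l K) : d ^ l = 1 := by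
  obtain ⟨x, rfl⟩ := QuotientGroup.mk'_surjective _ d
  rw [← map_pow]
  exact powerClass_eq_one_iff.2 ⟨x, rfl⟩

variable [Fact l.Prime] [Algebra ℚ_[l] K]

theorem coe_unitToField (u : (ringOfIntegers l K)ˣ) :
    (unitToField l K u : K) = ((u : ringOfIntegers l K) : K) := rfl

variable [FiniteDimensional ℚ_[l] K]

theorem exists_unitToField_eq {x : Kˣ} (hx : spectralValuation l K (x : K) = 1) :
    ∃ u : (ringOfIntegers l K)ˣ, unitToField l K u = x := by
  have hu : IsUnit (⟨x, (mem_ringOfIntegers_iff l _).2 hx.le⟩ : ringOfIntegers l K) :=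
    (isUnit_iff_spectralValuation_eq_one l _).2 hx
  exact ⟨hu.unit, Units.ext rfl⟩

theorem mem_ker_unitsMap_iff {π : ringOfIntegers l K} (hπ : Irreducible π) (n : ℕ)
    (u : (ringOfIntegers l K)ˣ) :
    u ∈ (Units.map (Ideal.Quotient.mk (maxIdeal l K ^ n) :
      ringOfIntegers l K →* ringOfIntegers l K ⧸ maxIdeal l K ^ n)).ker ↔
    spectralValuation l K (((u : ringOfIntegers l K) : K) - 1) ≤
      spectralValuation l K (π : K) ^ n := by
  have h := mem_maxIdeal_pow_iff hπ n ((u : ringOfIntegers l K) - 1)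
  push_cast at h
  rw [← h, MonoidHom.mem_ker, Units.ext_iff, ← Ideal.Quotient.mk_eq_mk_iff_sub_mem]
  simp

/-- A unit has its class in `Ū_n` when it is an `l`-th power modulo `𝔭 ^ n`. -/
theorem powerClass_mem_classFiltration_iff {π : ringOfIntegers l K} (hπ : Irreducible π) (n : ℕ)
    (u : (ringOfIntegers l K)ˣ) :
    powerClass l (unitToField l K u) ∈ classFiltration l K n ↔
      ∃ w : (ringOfIntegers l K)ˣ,
        spectralValuation l K
            (((u : ringOfIntegers l K) : K) - ((w : ringOfIntegers l K) : K) ^ l) ≤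
          spectralValuation l K (π : K) ^ n := by
  have hl := (Fact.out : l.Prime)
  constructor
  · rintro ⟨t, ⟨s, hs, rfl⟩, hsu⟩
    obtain ⟨c, hc⟩ := powerClass_eq_iff.1 hsu.symm
    -- The correcting `l`-th power is a quotient of units, so its root is a unit as well.
    have hc1 : spectralValuation l K (c : K) = 1 := by
      have h := congrArg (fun x : Kˣ => spectralValuation l K (x : K)) hc
      push_cast at h
      rw [map_mul, coe_unitToField, coe_unitToField, spectralValuation_unit,
        spectralValuation_unit, one_mul, map_pow] at h
      exact (pow_eq_one_iff_of_nonneg zero_le hl.ne_zero).1 h.symm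
    obtain ⟨w, rfl⟩ := exists_unitToField_eq hc1
    refine ⟨w, ?_⟩
    have h2 : ((u : ringOfIntegers l K) : K) - ((w : ringOfIntegers l K) : K) ^ l =
        (((s : ringOfIntegers l K) : K) - 1) * ((w : ringOfIntegers l K) : K) ^ l := by
      have h := congrArg (Units.val) hc
      push_cast [coe_unitToField] at h
      rw [h]
      ring
    rw [h2, map_mul, map_pow, spectralValuation_unit, one_pow, mul_one]
    exact (mem_ker_unitsMap_iff hπ n s).1 hs
  · rintro ⟨w, hw⟩
    refine ⟨unitToField l K (u * (w ^ l)⁻¹), ⟨_, (mem_ker_unitsMap_iff hπ n _).2 ?_, rfl⟩,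
      powerClass_eq_iff.2 ⟨unitToField l K w⁻¹, by simp [map_mul]⟩⟩
    have hw1 := spectralValuation_unit l w
    have hw0 : ((w : ringOfIntegers l K) : K) ≠ 0 := by
      rw [← Valuation.ne_zero_iff (spectralValuation l K), hw1]
      exact one_ne_zero
    have h2 : (((u * (w ^ l)⁻¹ : (ringOfIntegers l K)ˣ) : ringOfIntegers l K) : K) - 1 =
        (((u : ringOfIntegers l K) : K) - ((w : ringOfIntegers l K) : K) ^ l) *
          ((((w : ringOfIntegers l K) : K)) ^ l)⁻¹ := by
      have h3 : (((u * (w ^ l)⁻¹ : (ringOfIntegers l K)ˣ) : ringOfIntegers l K) : K) =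
          ((u : ringOfIntegers l K) : K) * ((((w : ringOfIntegers l K) : K)) ^ l)⁻¹ := by
        rw [← coe_unitToField, map_mul, map_inv, map_pow]
        push_cast
        rfl
      rw [h3, sub_mul, mul_inv_cancel₀ (pow_ne_zero _ hw0)]
    rw [h2, map_mul, map_inv₀, map_pow, hw1, one_pow, inv_one, mul_one]
    exact hw

theorem exists_unit_of_mem_classFiltration {π : ringOfIntegers l K} (hπ : Irreducible π) {n : ℕ}
    {d : PowerClasses l K} (hd : d ∈ classFiltration l K n) :
    ∃ u : (ringOfIntegers l K)ˣ, powerClass l (unitToField l K u) = d ∧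
      spectralValuation l K (((u : ringOfIntegers l K) : K) - 1) ≤
        spectralValuation l K (π : K) ^ n := by
  obtain ⟨t, ⟨s, hs, rfl⟩, rfl⟩ := hd
  exact ⟨s, rfl, (mem_ker_unitsMap_iff hπ n s).1 hs⟩

theorem powerClass_unit_mem_classFiltration {π : ringOfIntegers l K} (hπ : Irreducible π) {n : ℕ}
    {u : (ringOfIntegers l K)ˣ} (hu : spectralValuation l K (((u : ringOfIntegers l K) : K) - 1) ≤
        spectralValuation l K (π : K) ^ n) :
    powerClass l (unitToField l K u) ∈ classFiltration l K n :=
  ⟨_, ⟨u, (mem_ker_unitsMap_iff hπ n u).2 hu, rfl⟩, rfl⟩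

theorem exists_residue_eq_pow (a : ringOfIntegers l K) :
    ∃ d : ringOfIntegers l K, residue _ d ^ l = residue _ a := by
  obtain ⟨y, hy⟩ := (bijective_frobenius (residueField l K) l).2 (residue _ a)
  obtain ⟨d, rfl⟩ := residue_surjective y
  exact ⟨d, hy⟩

/-- The residue field is perfect, so every unit is an `l`-th power modulo `𝔭`; thus `Ū_0 = Ū_1`. -/
theorem powerClass_unit_mem_classFiltration_one (u : (ringOfIntegers l K)ˣ) :
    powerClass l (unitToField l K u) ∈ classFiltration l K 1 := by
  have hl := (Fact.out : l.Prime)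
  obtain ⟨π, hπ⟩ := IsDiscreteValuationRing.exists_irreducible (ringOfIntegers l K)
  obtain ⟨d, hd⟩ := exists_residue_eq_pow (u : ringOfIntegers l K)
  have hdu : IsUnit d := by
    rw [← residue_ne_zero_iff_isUnit]
    intro h
    rw [h, zero_pow hl.ne_zero] at hd
    exact (residue_ne_zero_iff_isUnit _).2 u.isUnit hd.symm
  refine (powerClass_mem_classFiltration_iff hπ 1 u).2 ⟨hdu.unit, ?_⟩
  have : (u : ringOfIntegers l K) - d ^ l ∈ maxIdeal l K ^ 1 := by
    rw [pow_one, ← residue_eq_zero_iff, map_sub, map_pow, hd, sub_self]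
  simpa using (mem_maxIdeal_pow_iff hπ 1 _).1 this

/-- The filtration on power classes jumps only at indices prime to `l` below `l e₁`. -/
theorem powerClass_mem_classFiltration_succ {ζ : K} (hζ : IsPrimitiveRoot ζ l) {s : ℕ}
    (hs : 0 < s) (hs1 : s < ramOne l K) {u : (ringOfIntegers l K)ˣ}
    (hu : powerClass l (unitToField l K u) ∈ classFiltration l K (l * s)) :
    powerClass l (unitToField l K u) ∈ classFiltration l K (l * s + 1) := by
  have hl := (Fact.out : l.Prime)
  obtain ⟨π, hπ⟩ := IsDiscreteValuationRing.exists_irreducible (ringOfIntegers l K)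
  rw [powerClass_mem_classFiltration_iff hπ] at hu ⊢
  obtain ⟨w, hw⟩ := hu
  -- Normalise to `u w⁻ˡ = 1 + π ^ (l s) c`. With `d ^ l ≡ c`, the leading term is then cancelled by
  -- `(1 + d π ^ s) ^ l`.
  have hdvd : π ^ (l * s) ∣ (u : ringOfIntegers l K) * (↑w⁻¹) ^ l - 1 := by
    have h1 : (u : ringOfIntegers l K) * (↑w⁻¹) ^ l - 1 =
        ((u : ringOfIntegers l K) - (w : ringOfIntegers l K) ^ l) * (↑w⁻¹) ^ l := by
      rw [sub_mul, ← mul_pow, Units.mul_inv, one_pow]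
    rw [h1]
    refine Dvd.dvd.mul_right ?_ _
    rw [dvd_iff_spectralValuation_le]
    push_cast
    rwa [map_pow]
  obtain ⟨c, hc⟩ := hdvd
  obtain ⟨d, hd⟩ := exists_residue_eq_pow c
  have hx : d * π ^ s ∈ maxIdeal l K :=
    Ideal.mul_mem_left _ _ (Ideal.pow_mem_of_mem _
      ((mem_maxIdeal_iff l π).2 (spectralValuation_irreducible_lt_one hπ)) s hs)
  obtain ⟨b, hb, -⟩ := exists_one_add_pow_prime_eq (p := l) hx
  have hunit : IsUnit (1 + d * π ^ s) := by
    rw [← residue_ne_zero_iff_isUnit, map_add, (residue_eq_zero_iff _).2 hx, map_one, add_zero]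
    exact one_ne_zero
  refine ⟨w * hunit.unit, ?_⟩
  -- The middle binomial terms are negligible: `s < e₁` gives `e₁ (l - 1) + s ≥ (s + 1) (l - 1) + s
  -- ≥ l s + 1`.
  have hl1 : (l : ringOfIntegers l K) * π ^ s ∈ maxIdeal l K ^ (l * s + 1) := by
    rw [mem_maxIdeal_pow_iff hπ]
    push_cast
    rw [map_mul, map_pow, spectralValuation_natCast_prime_eq_pow_ramOne hζ hπ, ← pow_add]
    refine pow_le_pow_of_le_one zero_le (spectralValuation_irreducible_lt_one hπ).le ?_
    obtain ⟨k, rfl⟩ : ∃ k, l = k + 2 := ⟨l - 2, by have := hl.two_le; omega⟩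
    have : (s + 1) * (k + 1) ≤ ramOne (k + 2) K * (k + 1) := Nat.mul_le_mul_right _ hs1
    have h2 : k + 2 - 1 = k + 1 := rfl
    rw [h2]
    nlinarith
  have hcd : π ^ (l * s) * (c - d ^ l) ∈ maxIdeal l K ^ (l * s + 1) := by
    rw [pow_succ]
    refine Ideal.mul_mem_mul (Ideal.pow_mem_pow
      ((mem_maxIdeal_iff l π).2 (spectralValuation_irreducible_lt_one hπ)) _) ?_
    rw [← residue_eq_zero_iff, map_sub, map_pow, hd, sub_self]
  have key : (u : ringOfIntegers l K) - ((w * hunit.unit : (ringOfIntegers l K)ˣ) :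
      ringOfIntegers l K) ^ l ∈ maxIdeal l K ^ (l * s + 1) := by
    have h1 : (u : ringOfIntegers l K) = (w : ringOfIntegers l K) ^ l * (1 + π ^ (l * s) * c) := by
      rw [← hc, add_sub_cancel, mul_left_comm, ← mul_pow, Units.mul_inv, one_pow, mul_one]
    have h2 : (u : ringOfIntegers l K) - ((w * hunit.unit : (ringOfIntegers l K)ˣ) :
        ringOfIntegers l K) ^ l = (w : ringOfIntegers l K) ^ l *
          (π ^ (l * s) * (c - d ^ l) - l * π ^ s * (d * b)) := by
      rw [Units.val_mul, IsUnit.unit_spec, mul_pow, hb, h1, mul_pow d, ← pow_mul, mul_comm s l]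
      ring
    rw [h2]
    exact Ideal.mul_mem_left _ _ (Ideal.sub_mem _ hcd (Ideal.mul_mem_right _ _ hl1))
  simpa using (mem_maxIdeal_pow_iff hπ _ _).1 key

end ClassFiltration

/-! ### The cokernel of `℘` on a finite field. -/

section ArtinSchreier

variable {p : ℕ} [Fact p.Prime] {k : Type*} [Field k] [CharP k p]

theorem artinSchreier_apply (x : k) : artinSchreier p k x = x ^ p - x := rfl

variable (p k) in
theorem card_ker_artinSchreier : Nat.card (artinSchreier p k).ker = p := by
  have h : ((artinSchreier p k).ker : Set k) = ((⊥ : Subfield k) : Set k) := by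
    ext x
    rw [SetLike.mem_coe, SetLike.mem_coe, AddMonoidHom.mem_ker, artinSchreier_apply, sub_eq_zero,
      Subfield.mem_bot_iff_pow_eq_self (F := k) (p := p)]
  exact (Nat.card_congr (Equiv.setCongr h)).trans (Subfield.card_bot k p)

-- The kernel of `℘` is the prime field, of order `p`. On a finite field the cokernel has the same
-- order, and a group of prime order is cyclic.
variable (p k) in
theorem exists_generatesArtinSchreier [Finite k] : ∃ c : k, GeneratesArtinSchreier p k c := by
  have hp := (Fact.out : p.Prime)
  have h1 := AddSubgroup.card_eq_card_quotient_mul_card_addSubgroup (artinSchreier p k).range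
  have h2 := AddSubgroup.card_eq_card_quotient_mul_card_addSubgroup (artinSchreier p k).ker
  rw [Nat.card_congr (QuotientAddGroup.quotientKerEquivRange (artinSchreier p k)).toEquiv,
    card_ker_artinSchreier, h1, mul_comm] at h2
  have hcard : Nat.card (k ⧸ (artinSchreier p k).range) = p :=
    Nat.eq_of_mul_eq_mul_left Nat.card_pos h2
  have : IsAddCyclic (k ⧸ (artinSchreier p k).range) := isAddCyclic_of_prime_card hcard
  obtain ⟨g, hg⟩ := IsAddCyclic.exists_generator (α := k ⧸ (artinSchreier p k).range)
  obtain ⟨c, rfl⟩ := QuotientAddGroup.mk_surjective g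
  exact ⟨c, (AddSubgroup.eq_top_iff' _).2 hg⟩

/-- Stated with `+` and a natural multiple so that it translates into multiplying a unit by a
natural power of the generator; finiteness makes natural multiples suffice. -/
theorem GeneratesArtinSchreier.exists_nsmul_add [Finite k] {c : k}
    (hc : GeneratesArtinSchreier p k c) (x : k) : ∃ (n : ℕ) (y : k), x + n • c = y ^ p - y := by
  have hx : (QuotientAddGroup.mk (-x) : k ⧸ (artinSchreier p k).range) ∈
      AddSubgroup.zmultiples (QuotientAddGroup.mk c : k ⧸ (artinSchreier p k).range) := by
    rw [hc]
    trivial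
  rw [← mem_multiples_iff_mem_zmultiples] at hx
  obtain ⟨n, hn⟩ := AddSubmonoid.mem_multiples_iff _ _ |>.1 hx
  rw [← QuotientAddGroup.mk_nsmul, eq_comm, QuotientAddGroup.eq, neg_neg] at hn
  obtain ⟨y, hy⟩ := hn
  exact ⟨n, y, hy.symm⟩

end ArtinSchreier

/-! ### The last nontrivial level `Ū_{l e₁}`. -/

section DeepestStep

variable {l : ℕ} [Fact l.Prime] {K : Type*} [Field K] [Algebra ℚ_[l] K] [FiniteDimensional ℚ_[l] K]

/-- The exponents add up as `e₁ (l - 1) + e₁ = l e₁`, so the elements of `U_{l e₁}` are exactly `1 -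
a l (1 - ζ)` with `a` integral. -/
theorem spectralValuation_prime_mul_one_sub {ζ : K} (hζ : IsPrimitiveRoot ζ l)
    {π : ringOfIntegers l K} (hπ : Irreducible π) :
    spectralValuation l K (l * (1 - ζ)) = spectralValuation l K (π : K) ^ (l * ramOne l K) := by
  have hl := (Fact.out : l.Prime)
  rw [map_mul, spectralValuation_natCast_prime_eq_pow_ramOne hζ hπ,
    spectralValuation_one_sub_primitiveRoot hζ hπ, ← pow_add]
  congr 1
  obtain ⟨k, rfl⟩ : ∃ k, l = k + 1 := ⟨l - 1, (Nat.sub_add_cancel hl.one_le).symm⟩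
  rw [Nat.add_sub_cancel]
  ring

theorem exists_eq_one_sub_mul {ζ : K} (hζ : IsPrimitiveRoot ζ l) {π : ringOfIntegers l K}
    (hπ : Irreducible π) {x : K}
    (hx : spectralValuation l K (x - 1) ≤ spectralValuation l K (π : K) ^ (l * ramOne l K)) :
    ∃ a : ringOfIntegers l K, x = 1 - a * l * (1 - ζ) := by
  rw [← spectralValuation_prime_mul_one_sub hζ hπ] at hx
  have h0 : (l : K) * (1 - ζ) ≠ 0 := by
    rw [← Valuation.ne_zero_iff (spectralValuation l K), spectralValuation_prime_mul_one_sub hζ hπ]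
    exact (pow_pos (spectralValuation_irreducible_pos hπ) _).ne'
  refine ⟨⟨(1 - x) / (l * (1 - ζ)), (mem_ringOfIntegers_iff l _).2 ?_⟩, ?_⟩
  · rw [map_div₀, Valuation.map_sub_swap]
    exact div_le_one_of_le₀ hx zero_le
  · rw [mul_assoc, div_mul_cancel₀ _ h0]
    ring

theorem spectralValuation_one_sub_mul_sub_one_le {ζ : K} (hζ : IsPrimitiveRoot ζ l)
    {π : ringOfIntegers l K} (hπ : Irreducible π) (a : ringOfIntegers l K) :
    spectralValuation l K (1 - a * l * (1 - ζ) - 1) ≤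
      spectralValuation l K (π : K) ^ (l * ramOne l K) := by
  rw [← spectralValuation_prime_mul_one_sub hζ hπ, sub_sub_cancel_left, Valuation.map_neg,
    mul_assoc, map_mul]
  exact mul_le_of_le_one_left' (spectralValuation_coe_le_one l a)

theorem spectralValuation_eq_one_of_sub_one_lt_one {x : K}
    (hx : spectralValuation l K (x - 1) < 1) : spectralValuation l K x = 1 := by
  have h : spectralValuation l K (x - 1) < spectralValuation l K 1 := by rwa [map_one]
  have := Valuation.map_add_eq_of_lt_left _ h
  rwa [add_sub_cancel, map_one] at this

theorem exists_unit_eq_one_sub_mul {ζ : K} (hζ : IsPrimitiveRoot ζ l) (a : ringOfIntegers l K) :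
    ∃ μ : (ringOfIntegers l K)ˣ, (unitToField l K μ : K) = 1 - a * l * (1 - ζ) := by
  obtain ⟨π, hπ⟩ := IsDiscreteValuationRing.exists_irreducible (ringOfIntegers l K)
  have h := spectralValuation_one_sub_mul_sub_one_le hζ hπ a
  have h1 := spectralValuation_eq_one_of_sub_one_lt_one (h.trans_lt (pow_lt_one₀ zero_le
    (spectralValuation_irreducible_lt_one hπ)
    (mul_pos (Fact.out : l.Prime).pos (ramOne_pos hζ)).ne'))
  have h0 : 1 - a * l * (1 - ζ) ≠ 0 := by
    rw [← Valuation.ne_zero_iff (spectralValuation l K), h1]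
    exact one_ne_zero
  obtain ⟨u, hu⟩ := exists_unitToField_eq (x := Units.mk0 _ h0) h1
  exact ⟨u, by rw [hu, Units.val_mk0]⟩

/-- If the parameter lies in the image of the Artin-Schreier map, then the unit is an `l`-th
power. -/
theorem exists_pow_eq_one_sub_mul {ζ : K} (hζ : IsPrimitiveRoot ζ l) (a : ringOfIntegers l K)
    {y : residueField l K} (hy : residue _ a = y ^ l - y) :
    ∃ b : K, b ^ l = 1 - a * l * (1 - ζ) := by
  have hl := (Fact.out : l.Prime)
  obtain ⟨u, hu⟩ := exists_unit_eq_one_sub_mul hζ a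
  have hu1 : spectralValuation l K (1 - a * l * (1 - ζ)) = 1 := by
    rw [← hu]
    exact spectralValuation_unit l u
  obtain ⟨z, rfl, hz⟩ := exists_coe_eq_primitiveRoot hζ
  obtain ⟨c, hc, hc1⟩ := exists_natCast_prime_eq_pow_mul hz
  obtain ⟨b, rfl⟩ := residue_surjective y
  obtain ⟨t, ht, ht1⟩ := exists_one_add_one_sub_mul_pow hz b
  -- The residues cancel: `t` reduces to `y ^ l - y`, and `a c` to its negative because `c ≡ -1`.
  -- This gives the strict inequality that the Hensel step needs.
  have hlast : spectralValuation l K ((t + a * c : ringOfIntegers l K) : K) < 1 := by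
    rw [← mem_maxIdeal_iff, ← residue_eq_zero_iff, map_add, map_mul, ht1, hc1, hy]
    ring
  refine exists_pow_eq_of_spectralValuation_sub_lt hζ (ξ := ((1 + (1 - z) * b :
    ringOfIntegers l K) : K)) hu1 ?_
  have hl1 : (1 - z) ^ l = (1 - z) ^ (l - 1) * (1 - z) := by
    rw [← pow_succ, Nat.sub_add_cancel hl.one_le]
  have key : (1 + (1 - z) * b) ^ l - (1 - a * l * (1 - z)) = (1 - z) ^ l * (t + a * c) := by
    rw [ht, hc, hl1]
    ring
  have key' := congrArg (algebraMap (ringOfIntegers l K) K) key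
  have h3 : ((1 + (1 - z) * b : ringOfIntegers l K) : K) ^ l - (1 - a * l * (1 - z)) =
      (1 - z : K) ^ l * ((t + a * c : ringOfIntegers l K) : K) := by
    simpa using key'
  rw [h3, map_mul, map_pow]
  refine mul_lt_of_lt_one_right (pow_pos ?_ l) hlast
  rw [zero_lt_iff, Valuation.ne_zero_iff, sub_ne_zero]
  exact (hζ.ne_one hl.one_lt).symm

/-- Multiplying units adds their parameters up to a cross term divisible by `l`, which dies in the
residue field. -/
theorem exists_pow_eq_one_sub_mul_nsmul {ζ : K} (hζ : IsPrimitiveRoot ζ l)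
    (a b : ringOfIntegers l K) (n : ℕ) :
    ∃ c : ringOfIntegers l K, residue _ c = residue _ a + n • residue _ b ∧
      (1 - a * l * (1 - ζ)) * (1 - b * l * (1 - ζ)) ^ n = 1 - c * l * (1 - ζ) := by
  induction n with
  | zero => exact ⟨a, by simp, by simp⟩
  | succ n ih =>
    obtain ⟨c, hc, h⟩ := ih
    obtain ⟨z, rfl, hz⟩ := exists_coe_eq_primitiveRoot hζ
    refine ⟨c + b - c * b * l * (1 - z), ?_, ?_⟩
    · have h0 : residue (ringOfIntegers l K) (l : ringOfIntegers l K) = 0 :=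
        (residue_eq_zero_iff _).2 (natCast_mem_maximalIdeal l K)
      rw [map_sub, map_add, map_mul, map_mul, h0, mul_zero, zero_mul, sub_zero, hc, succ_nsmul,
        add_assoc]
    · rw [pow_succ, ← mul_assoc, h]
      push_cast
      ring

/-- The group `Ū_{l e₁}` is generated by the class of `1 - η l (1 - ζ)`. -/
theorem classFiltration_eq_zpowers {ζ : K} (hζ : IsPrimitiveRoot ζ l) {η : ringOfIntegers l K}
    (hη : GeneratesArtinSchreier l (residueField l K) (residue _ η)) {μ : (ringOfIntegers l K)ˣ}
    (hμ : (unitToField l K μ : K) = 1 - η * l * (1 - ζ)) :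
    classFiltration l K (l * ramOne l K) =
      Subgroup.zpowers (powerClass l (unitToField l K μ)) := by
  have hl := (Fact.out : l.Prime)
  obtain ⟨π, hπ⟩ := IsDiscreteValuationRing.exists_irreducible (ringOfIntegers l K)
  apply le_antisymm
  · intro d hd
    obtain ⟨u, rfl, hu⟩ := exists_unit_of_mem_classFiltration hπ hd
    obtain ⟨a, ha⟩ := exists_eq_one_sub_mul hζ hπ hu
    -- Multiplying `u` by `μ ^ n` moves its parameter into `℘(k)`, so `u μ ^ n` is an `l`-th power.
    obtain ⟨n, y, hny⟩ := hη.exists_nsmul_add (residue _ a)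
    obtain ⟨c, hc, hc1⟩ := exists_pow_eq_one_sub_mul_nsmul hζ a η n
    obtain ⟨b, hb⟩ := exists_pow_eq_one_sub_mul hζ c (hc.trans hny)
    rw [← hc1, ← ha, ← hμ, ← coe_unitToField] at hb
    have hb0 : b ≠ 0 := by
      rintro rfl
      rw [zero_pow hl.ne_zero, ← Units.val_pow_eq_pow_val, ← Units.val_mul] at hb
      exact (Units.ne_zero _) hb.symm
    have h1 : powerClass l (unitToField l K u * unitToField l K μ ^ n) = 1 := by
      refine powerClass_eq_one_iff.2 ⟨Units.mk0 b hb0, Units.ext ?_⟩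
      push_cast
      exact hb
    rw [map_mul, map_pow] at h1
    have h2 : powerClass l (unitToField l K u) = (powerClass l (unitToField l K μ) ^ n)⁻¹ :=
      eq_inv_of_mul_eq_one_left h1
    rw [h2]
    exact Subgroup.inv_mem _ (Subgroup.pow_mem _ (Subgroup.mem_zpowers _) n)
  · rw [Subgroup.zpowers_le]
    apply powerClass_unit_mem_classFiltration hπ
    rw [← coe_unitToField, hμ]
    exact spectralValuation_one_sub_mul_sub_one_le hζ hπ η

end DeepestStep

/-! ### Lines and their position in the filtration. -/

section Lines

variable {l : ℕ} [Fact l.Prime] {K : Type*} [Field K] {D : Subgroup (PowerClasses l K)}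

theorem IsLine.finite (hD : IsLine D) : Finite D :=
  Nat.finite_of_card_ne_zero (by rw [hD]; exact (Fact.out : l.Prime).ne_zero)

theorem IsLine.zpowers_eq (hD : IsLine D) {d : PowerClasses l K} (hd : d ∈ D) (h1 : d ≠ 1) :
    Subgroup.zpowers d = D := by
  have := hD.finite
  have hle : Subgroup.zpowers d ≤ D := Subgroup.zpowers_le.2 hd
  refine Subgroup.eq_of_le_of_card_ge hle ?_
  rw [show Nat.card D = l from hD, Nat.card_zpowers,
    orderOf_eq_prime (powerClass_pow_eq_one d) h1]

theorem IsLine.exists_ne_one (hD : IsLine D) : ∃ d ∈ D, d ≠ 1 := by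
  by_contra! h
  have : D = ⊥ := (Subgroup.eq_bot_iff_forall D).2 h
  have h1 : Nat.card D = l := hD
  rw [this, Subgroup.card_bot] at h1
  exact (Fact.out : l.Prime).ne_one h1.symm

theorem IsLine.ne_one (hD : IsLine D) {d : PowerClasses l K} (hd : Subgroup.zpowers d = D) :
    d ≠ 1 := by
  rintro rfl
  obtain ⟨x, hx, hx1⟩ := hD.exists_ne_one
  rw [← hd, Subgroup.zpowers_one_eq_bot] at hx
  exact hx1 hx

theorem pow_ne_of_powerClass_ne_one {μ : Kˣ} (h : powerClass l μ ≠ 1) (b : K) : b ^ l ≠ μ := by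
  intro hb
  have hb0 : b ≠ 0 := by
    rintro rfl
    rw [zero_pow (Fact.out : l.Prime).ne_zero] at hb
    exact μ.ne_zero hb.symm
  exact h (powerClass_eq_one_iff.2 ⟨Units.mk0 b hb0, Units.ext hb⟩)

variable [Algebra ℚ_[l] K] [FiniteDimensional ℚ_[l] K]

theorem classFiltration_antitone : Antitone (classFiltration l K) := by
  intro m n hmn d hd
  obtain ⟨π, hπ⟩ := IsDiscreteValuationRing.exists_irreducible (ringOfIntegers l K)
  obtain ⟨u, rfl, hu⟩ := exists_unit_of_mem_classFiltration hπ hd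
  exact powerClass_unit_mem_classFiltration hπ (hu.trans
    (pow_le_pow_of_le_one zero_le (spectralValuation_irreducible_lt_one hπ).le hmn))

theorem exists_unit_of_mem_classFiltration_one {d : PowerClasses l K}
    (hd : d ∈ classFiltration l K 1) :
    ∃ u : (ringOfIntegers l K)ˣ, powerClass l (unitToField l K u) = d := by
  obtain ⟨t, ⟨s, hs, rfl⟩, rfl⟩ := hd
  exact ⟨s, rfl⟩

/-- A line contained in `Ū_{l e₁}` is equal to it. -/
theorem IsLine.eq_classFiltration (hD : IsLine D) {ζ : K} (hζ : IsPrimitiveRoot ζ l)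
    (hle : D ≤ classFiltration l K (l * ramOne l K)) :
    D = classFiltration l K (l * ramOne l K) := by
  obtain ⟨c, hc⟩ := exists_generatesArtinSchreier l (residueField l K)
  obtain ⟨η, rfl⟩ := residue_surjective c
  obtain ⟨μ, hμ⟩ := exists_unit_eq_one_sub_mul hζ η
  have h := classFiltration_eq_zpowers hζ hc hμ
  rw [h] at hle ⊢
  have hfin : IsOfFinOrder (powerClass l (unitToField l K μ)) :=
    isOfFinOrder_iff_pow_eq_one.2 ⟨l, (Fact.out : l.Prime).pos, powerClass_pow_eq_one _⟩
  have : Finite (Subgroup.zpowers (powerClass l (unitToField l K μ))) := by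
    exact hfin.finite_zpowers
  -- The cyclic group on the right is killed by `l`, so it has at most `l` elements, the number that
  -- `D` has; that its generator is nontrivial need not be known.
  refine Subgroup.eq_of_le_of_card_ge hle ?_
  rw [show Nat.card D = l from hD, Nat.card_zpowers]
  exact Nat.le_of_dvd (Fact.out : l.Prime).pos (orderOf_dvd_of_pow_eq_one (powerClass_pow_eq_one _))

/-- A line falls under one of three cases. -/
theorem IsLine.trichotomy (hD : IsLine D) {ζ : K} (hζ : IsPrimitiveRoot ζ l) :
    ¬ D ≤ classFiltration l K 1 ∨
      (D ≤ classFiltration l K 1 ∧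
        ∃ m < l * ramOne l K, D ≤ classFiltration l K m ∧ ¬ D ≤ classFiltration l K (m + 1)) ∨
      D = classFiltration l K (l * ramOne l K) := by
  by_cases h1 : D ≤ classFiltration l K 1
  · by_cases h2 : D ≤ classFiltration l K (l * ramOne l K)
    · exact Or.inr (Or.inr (hD.eq_classFiltration hζ h2))
    · refine Or.inr (Or.inl ⟨h1, ?_⟩)
      by_contra! h
      have key : ∀ m ≤ l * ramOne l K, D ≤ classFiltration l K m := by
        intro m
        induction m with
        | zero => exact fun _ => h1.trans (classFiltration_antitone zero_le_one)
        | succ m ih => exact fun hm => h m hm (ih (Nat.le_of_succ_le hm))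
      exact h2 (key _ le_rfl)
  · exact Or.inl h1

/-- A line which is not contained in `Ū_1` contains the class of a uniformiser. -/
theorem exists_isUniformiser_powerClass_mem (h : ¬ D ≤ classFiltration l K 1) :
    ∃ μ : Kˣ, IsUniformiser l K μ ∧ powerClass l μ ∈ D := by
  obtain ⟨π, hπ⟩ := IsDiscreteValuationRing.exists_irreducible (ringOfIntegers l K)
  obtain ⟨d, hd, hd1⟩ := SetLike.not_le_iff_exists.1 h
  obtain ⟨x, rfl⟩ := QuotientGroup.mk'_surjective _ d
  obtain ⟨N, hN⟩ := exists_spectralValuation_eq_zpow hπ x.ne_zero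
  have hπ0 : (π : K) ≠ 0 := fun h => hπ.ne_zero (Subtype.ext h)
  have hq := (spectralValuation_irreducible_pos hπ).ne'
  -- If `l ∣ N`, an `l`-th power of a power of `π` turns `x` into a unit, whose class lies in `Ū_1`.
  -- Otherwise `a N + b l = 1`, and `x ^ a π ^ (b l)` has valuation `1`.
  by_cases hdvd : (l : ℤ) ∣ N
  · obtain ⟨s, rfl⟩ := hdvd
    exfalso
    obtain ⟨u, hu⟩ := exists_unitToField_eq (x := x * ((Units.mk0 (π : K) hπ0) ^ (-s)) ^ l) (by
      push_cast
      rw [map_mul, hN, map_pow, map_zpow₀, ← zpow_natCast, ← zpow_mul, Units.val_mk0,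
        ← zpow_add₀ hq]
      convert zpow_zero _ using 2
      ring)
    have h2 := powerClass_unit_mem_classFiltration_one u
    rw [powerClass_eq_iff.2 ⟨_, hu⟩] at h2
    exact hd1 h2
  · have hcop : IsCoprime N (l : ℤ) := by
      refine ((Nat.prime_iff_prime_int.1 (Fact.out : l.Prime)).coprime_iff_not_dvd.2 hdvd).symm
    obtain ⟨a, b, hab⟩ := hcop
    refine ⟨x ^ a * ((Units.mk0 (π : K) hπ0) ^ b) ^ l, ?_, ?_⟩
    · rw [isUniformiser_iff hπ]
      push_cast
      rw [map_mul, map_zpow₀, hN, map_pow, map_zpow₀, ← zpow_natCast, ← zpow_mul, ← zpow_mul,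
        Units.val_mk0, ← zpow_add₀ hq]
      convert zpow_one _ using 2
      rw [← hab]
      ring
    · rw [powerClass_eq_iff.2 ⟨_, rfl⟩, map_zpow]
      exact Subgroup.zpow_mem _ hd a

end Lines

/-! ### Orthogonal powers and monogenic rings of integers. -/

section Monogenic

variable {l : ℕ} [Fact l.Prime] {K L : Type*} [Field K] [Algebra ℚ_[l] K]
  [Field L] [Algebra ℚ_[l] L] [FiniteDimensional ℚ_[l] L]
  [Algebra K L]

variable (l K) in
/-- The powers `1, A, …, A ^ (n - 1)` are orthogonal for the absolute value. -/
def HasOrthogonalPowers (n : ℕ) (A : L) : Prop :=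
  ∀ (a : Fin n → K) (i : Fin n),
    spectralValuation l L (algebraMap K L (a i) * A ^ (i : ℕ)) ≤
      spectralValuation l L (∑ j, algebraMap K L (a j) * A ^ (j : ℕ))

variable [IsScalarTower ℚ_[l] K L]

/-- In a vanishing combination every term is bounded by `0`, so the powers are independent; there
are as many as the degree. -/
theorem HasOrthogonalPowers.exists_eq_sum {n : ℕ} {A : L} (h : HasOrthogonalPowers l K n A)
    (hn : Module.finrank K L = n) (hA : A ≠ 0) (z : L) :
    ∃ a : Fin n → K, z = ∑ j, algebraMap K L (a j) * A ^ (j : ℕ) := by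
  have hli : LinearIndependent K (fun j : Fin n => A ^ (j : ℕ)) := by
    rw [Fintype.linearIndependent_iff]
    intro a ha i
    have hi := h a i
    simp only [Algebra.smul_def] at ha
    rw [ha, map_zero, nonpos_iff_eq_zero, map_eq_zero] at hi
    simpa [hA] using hi
  have : FiniteDimensional K L := Module.Finite.of_restrictScalars_finite ℚ_[l] K L
  have hspan := hli.span_eq_top_of_card_eq_finrank' (by rw [Fintype.card_fin, hn])
  have hz : z ∈ Submodule.span K (Set.range fun j : Fin n => A ^ (j : ℕ)) := by
    rw [hspan]
    trivial
  obtain ⟨a, ha⟩ := (Submodule.mem_span_range_iff_exists_fun K).1 hz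
  exact ⟨a, by simp only [← ha, Algebra.smul_def]⟩

variable [FiniteDimensional ℚ_[l] K]

/-- Orthogonality makes each term of an integral sum integral; `h1` passes from the term to its
coefficient. It is trivial when `|A| = 1`, and in the ramified case follows from `i < n`. -/
theorem HasOrthogonalPowers.isIntegralGenerator {n : ℕ} {A : L} (h : HasOrthogonalPowers l K n A)
    (hn : Module.finrank K L = n) (hA : A ≠ 0) (hA1 : spectralValuation l L A ≤ 1)
    (h1 : ∀ (x : K) (i : Fin n), spectralValuation l K x * spectralValuation l L A ^ (i : ℕ) ≤ 1 →
      spectralValuation l K x ≤ 1) :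
    IsIntegralGenerator l K L A := by
  ext z
  rw [SetLike.mem_coe, SetLike.mem_coe, mem_ringOfIntegers_iff]
  constructor
  · intro hz
    obtain ⟨a, rfl⟩ := h.exists_eq_sum hn hA z
    refine Subalgebra.sum_mem _ fun j _ => Subalgebra.mul_mem _ ?_
      (Subalgebra.pow_mem _ (Algebra.self_mem_adjoin_singleton _ _) _)
    have hj : spectralValuation l K (a j) ≤ 1 := by
      refine h1 (a j) j ?_
      rw [← spectralValuation_algebraMap l L, ← map_pow, ← map_mul]
      exact (h a j).trans hz
    exact Subalgebra.algebraMap_mem (Algebra.adjoin (ringOfIntegers l K) {A})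
      ⟨a j, (mem_ringOfIntegers_iff l _).2 hj⟩
  · intro hz
    induction hz using Algebra.adjoin_induction with
    | mem x hx =>
      rw [Set.mem_singleton_iff.1 hx]
      exact hA1
    | algebraMap r =>
      have hr : algebraMap (ringOfIntegers l K) L r = algebraMap K L (r : K) := rfl
      rw [hr, spectralValuation_algebraMap]
      exact spectralValuation_coe_le_one l r
    | add x y _ _ hx hy => exact (Valuation.map_add _ x y).trans (max_le hx hy)
    | mul x y _ _ hx hy =>
      rw [map_mul]
      exact mul_le_one' hx hy

/-- By the ultrametric inequality some term is at least as large as the sum, and orthogonality gives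
equality. This determines the value group of `L`. -/
theorem HasOrthogonalPowers.exists_spectralValuation_eq {n : ℕ} {A : L}
    (h : HasOrthogonalPowers l K n A)
    (hn : Module.finrank K L = n) (hA : A ≠ 0) {z : L} (hz : z ≠ 0) :
    ∃ (x : K) (i : Fin n), x ≠ 0 ∧
      spectralValuation l L z = spectralValuation l K x * spectralValuation l L A ^ (i : ℕ) := by
  obtain ⟨a, rfl⟩ := h.exists_eq_sum hn hA z
  have hpos : spectralValuation l L (∑ j, algebraMap K L (a j) * A ^ (j : ℕ)) ≠ 0 :=
    (Valuation.ne_zero_iff _).2 hz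
  obtain ⟨i, hi⟩ : ∃ i : Fin n, spectralValuation l L (∑ j, algebraMap K L (a j) * A ^ (j : ℕ)) ≤
      spectralValuation l L (algebraMap K L (a i) * A ^ (i : ℕ)) := by
    by_contra! hlt
    exact lt_irrefl _ (Valuation.map_sum_lt _ hpos fun i _ => hlt i)
  have heq := le_antisymm hi (h a i)
  refine ⟨a i, i, ?_, ?_⟩
  · intro h0
    rw [h0, map_zero, zero_mul, map_zero] at heq
    exact hpos heq
  · rw [heq, map_mul, map_pow, spectralValuation_algebraMap]

/-- An element whose absolute value is an `n`-th root of the one of a uniformiser is orthogonal. -/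
theorem hasOrthogonalPowers_of_pow_eq {π : ringOfIntegers l K} (hπ : Irreducible π) {n : ℕ}
    {A : L} (hA : spectralValuation l L A ^ n = spectralValuation l K (π : K)) :
    HasOrthogonalPowers l K n A := by
  intro a i
  have : Nonempty (Fin n) := ⟨i⟩
  have hn : n ≠ 0 := by
    have := i.pos
    omega
  set r := spectralValuation l L A with hr
  have hr0 : 0 < r := by
    rw [zero_lt_iff]
    rintro h0
    rw [h0, zero_pow hn] at hA
    exact (spectralValuation_irreducible_pos hπ).ne hA
  have hr1 : r < 1 := by
    by_contra! h
    have := one_le_pow₀ h (n := n)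
    rw [hA] at this
    exact not_lt.2 this (spectralValuation_irreducible_lt_one hπ)
  let t : Fin n → L := fun j => algebraMap K L (a j) * A ^ (j : ℕ)
  obtain ⟨j, -, hj⟩ := Finset.exists_max_image Finset.univ (fun j => spectralValuation l L (t j))
    Finset.univ_nonempty
  refine (hj i (Finset.mem_univ i)).trans ?_
  -- The exponent of the `i`-th term is `i` modulo `n`, so nonzero terms have distinct values and
  -- the largest one dominates the sum.
  have hval : ∀ i, a i ≠ 0 → ∃ N : ℤ, spectralValuation l L (t i) = r ^ (n * N + i) := by
    intro i hi
    obtain ⟨N, hN⟩ := exists_spectralValuation_eq_zpow hπ hi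
    refine ⟨N, ?_⟩
    rw [map_mul, map_pow, spectralValuation_algebraMap, hN, ← hA, zpow_add₀ hr0.ne', zpow_mul,
      zpow_natCast, zpow_natCast]
  by_cases hj0 : a j = 0
  · simp [t, hj0]
  · have hne : t j ≠ 0 := by
      refine mul_ne_zero ((_root_.map_ne_zero _).2 hj0) (pow_ne_zero _ ?_)
      rintro rfl
      rw [map_zero] at hr
      exact hr0.ne' hr
    have heq := Valuation.map_sum_eq_of_lt (spectralValuation l L) (s := Finset.univ) (f := t)
      (Finset.mem_univ j) (by
        intro i hi
        have hij : i ≠ j := by simpa using hi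
        refine lt_of_le_of_ne (hj i (Finset.mem_univ i)) fun hval_eq => hij ?_
        have hi0 : a i ≠ 0 := by
          intro h0
          have : t i = 0 := by simp [t, h0]
          rw [this, map_zero] at hval_eq
          exact (Valuation.ne_zero_iff _).2 hne hval_eq.symm
        obtain ⟨N, hN⟩ := hval i hi0
        obtain ⟨M, hM⟩ := hval j hj0
        rw [hN, hM] at hval_eq
        have h1 := (zpow_right_injective₀ hr0 hr1.ne) hval_eq
        have h2 : ((i : ℕ) : ℤ) % n = ((j : ℕ) : ℤ) % n := by
          have h3 := congrArg (· % (n : ℤ)) h1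
          simpa using h3
        rw [Int.emod_eq_of_lt (by omega) (by omega), Int.emod_eq_of_lt (by omega) (by omega)] at h2
        exact Fin.ext (by exact_mod_cast h2))
    exact heq.ge

/-- The totally ramified case: an element of the right absolute value is a uniformiser, and
generates the ring of integers. -/
theorem isUniformiser_and_isIntegralGenerator_of_pow_eq {π : ringOfIntegers l K}
    (hπ : Irreducible π) {n : ℕ} (hn : Module.finrank K L = n) (hn0 : n ≠ 0) {A : L}
    (hA : spectralValuation l L A ^ n = spectralValuation l K (π : K)) :
    IsUniformiser l L A ∧ IsIntegralGenerator l K L A := by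
  have horth := hasOrthogonalPowers_of_pow_eq hπ hA
  have hr0 : 0 < spectralValuation l L A := by
    rw [zero_lt_iff]
    rintro h0
    rw [h0, zero_pow hn0] at hA
    exact (spectralValuation_irreducible_pos hπ).ne hA
  have hA0 : A ≠ 0 := (Valuation.ne_zero_iff _).1 hr0.ne'
  have hr1 : spectralValuation l L A < 1 := by
    by_contra! h
    have := one_le_pow₀ h (n := n)
    rw [hA] at this
    exact not_lt.2 this (spectralValuation_irreducible_lt_one hπ)
  have hval : ∀ (x : K) (i : Fin n), x ≠ 0 → ∃ N : ℤ, spectralValuation l K x =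
      spectralValuation l L A ^ (n * N) ∧ spectralValuation l K x *
        spectralValuation l L A ^ (i : ℕ) = spectralValuation l L A ^ (n * N + i) := by
    intro x i hx
    obtain ⟨N, hN⟩ := exists_spectralValuation_eq_zpow hπ hx
    have : spectralValuation l K x = spectralValuation l L A ^ (n * N) := by
      rw [hN, ← hA, zpow_mul, zpow_natCast]
    exact ⟨N, this, by rw [this, zpow_add₀ hr0.ne', zpow_natCast]⟩
  constructor
  · refine isUniformiser_of_spectralValuation hr1 fun z hz => ?_
    by_cases hz0 : z = 0
    · rw [hz0, map_zero]
      exact zero_le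
    · obtain ⟨x, i, hx, hzx⟩ := horth.exists_spectralValuation_eq hn hA0 hz0
      obtain ⟨N, -, hN⟩ := hval x i hx
      rw [hzx, hN] at hz ⊢
      rw [← zpow_zero (spectralValuation l L A), zpow_lt_zpow_iff_right_of_lt_one₀ hr0 hr1] at hz
      calc _ ≤ spectralValuation l L A ^ (1 : ℤ) :=
            (zpow_le_zpow_iff_right_of_lt_one₀ hr0 hr1).2 (by omega)
        _ = _ := zpow_one _
  · refine horth.isIntegralGenerator hn hA0 hr1.le fun x i hx => ?_
    by_cases hx0 : x = 0
    · rw [hx0, map_zero]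
      exact zero_le
    · obtain ⟨N, hN1, hN⟩ := hval x i hx0
      rw [hN, ← zpow_zero (spectralValuation l L A),
        zpow_le_zpow_iff_right_of_lt_one₀ hr0 hr1] at hx
      rw [hN1, ← zpow_zero (spectralValuation l L A), zpow_le_zpow_iff_right_of_lt_one₀ hr0 hr1]
      have hi := i.2
      -- From `n N + i ≥ 0` and `i < n`: a negative `N` would make the exponent negative.
      have hN0 : 0 ≤ N := by
        by_contra! hneg
        have : (n : ℤ) * N ≤ n * (-1) := mul_le_mul_of_nonneg_left (by omega) (by omega)
        omega
      positivity

/-- The unramified case. -/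
theorem isUniformiser_and_isIntegralGenerator_of_eq_one {n : ℕ} (hn : Module.finrank K L = n)
    {A : L} (hA : spectralValuation l L A = 1) (horth : HasOrthogonalPowers l K n A) :
    (∀ lam : K, IsUniformiser l K lam → IsUniformiser l L (algebraMap K L lam)) ∧
      IsIntegralGenerator l K L A := by
  have hA0 : A ≠ 0 := by
    rw [← Valuation.ne_zero_iff (spectralValuation l L), hA]
    exact one_ne_zero
  constructor
  · intro lam hlam
    obtain ⟨π, rfl, hπ⟩ := hlam.exists_irreducible
    refine isUniformiser_of_spectralValuation ?_ fun z hz => ?_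
    · rw [spectralValuation_algebraMap]
      exact spectralValuation_irreducible_lt_one hπ
    · by_cases hz0 : z = 0
      · rw [hz0, map_zero]
        exact zero_le
      · obtain ⟨x, i, hx, hzx⟩ := horth.exists_spectralValuation_eq hn hA0 hz0
        rw [hA, one_pow, mul_one] at hzx
        rw [hzx] at hz ⊢
        rw [spectralValuation_algebraMap]
        exact spectralValuation_le_of_lt_one hπ hz
  · refine horth.isIntegralGenerator hn hA0 hA.le fun x i hx => ?_
    rwa [hA, one_pow, mul_one] at hx

end Monogenic

/-! ### Orthogonality from distinct residues of the conjugates. -/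

section Unramified

variable {l : ℕ} [Fact l.Prime] {K L : Type*} [Field K] [Algebra ℚ_[l] K]
  [FiniteDimensional ℚ_[l] K] [Field L] [Algebra ℚ_[l] L] [FiniteDimensional ℚ_[l] L]
  [Algebra K L] [IsScalarTower ℚ_[l] K L]

/-- If `μ` is close to `1`, an integral combination of the powers of `(ρ - 1) / (1 - ζ)` with a
small value has small coefficients: its reduction vanishes at the `l` distinct reductions of the
conjugates of `(ρ - 1) / (1 - ζ)`. -/
theorem spectralValuation_coeff_lt_one {ζ : K} (hζ : IsPrimitiveRoot ζ l) {μ : K}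
    (hμ : ∀ b : K, b ^ l ≠ μ)
    (hμ1 : spectralValuation l K (1 - μ) ≤ spectralValuation l K (1 - ζ) ^ l) {ρ : L}
    (hρ : ρ ^ l = algebraMap K L μ) {b : Fin l → K} (hb : ∀ i, spectralValuation l K (b i) ≤ 1)
    (hsum : spectralValuation l L
      (∑ j, algebraMap K L (b j) * ((ρ - 1) / (1 - algebraMap K L ζ)) ^ (j : ℕ)) < 1) (i : Fin l) :
    spectralValuation l K (b i) < 1 := by
  have hl := (Fact.out : l.Prime)
  have hζL : IsPrimitiveRoot (algebraMap K L ζ) l := hζ.map_of_injective (algebraMap K L).injective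
  obtain ⟨z₀, hz₀, hz₀'⟩ := exists_coe_eq_primitiveRoot hζL
  have hδ0 : (1 - algebraMap K L ζ) ≠ 0 := sub_ne_zero.2 (hζL.ne_one hl.one_lt).symm
  have hδ : spectralValuation l L (1 - algebraMap K L ζ) = spectralValuation l K (1 - ζ) := by
    rw [← spectralValuation_algebraMap l L (1 - ζ), map_sub (algebraMap K L), map_one]
  have hμv : spectralValuation l K μ = 1 := by
    apply spectralValuation_eq_one_of_sub_one_lt_one
    rw [Valuation.map_sub_swap]
    exact hμ1.trans_lt (pow_lt_one₀ zero_le (spectralValuation_one_sub_primitiveRoot_lt_one hζ)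
      hl.ne_zero)
  have hρv : spectralValuation l L ρ = 1 := by
    have h : spectralValuation l L ρ ^ l = 1 := by
      rw [← map_pow, hρ, spectralValuation_algebraMap, hμv]
    exact (pow_eq_one_iff_of_nonneg zero_le hl.ne_zero).1 h
  let α : L → L := fun z => (z * ρ - 1) / (1 - algebraMap K L ζ)
  -- The norm identity with `ξ = 1` gives `|1 - zρ| ^ l = |1 - μ| ≤ |1 - ζ| ^ l`.
  have hα : ∀ z : L, z ^ l = 1 → α z ∈ ringOfIntegers l L := by
    intro z hz
    have h1 := spectralValuation_sub_rootOfUnity_mul hμ hρ hz 1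
    have h2 := spectralValuation_sub_root_pow hζ hμ hρ 1
    rw [one_pow, ← h1] at h2
    rw [← h2, map_one, Valuation.map_sub_swap] at hμ1
    have h3 := le_of_pow_le_pow_left₀ hl.ne_zero zero_le hμ1
    rw [mem_ringOfIntegers_iff, map_div₀, hδ]
    exact div_le_one_of_le₀ h3 zero_le
  let bL : Fin l → ringOfIntegers l L := fun i => ⟨algebraMap K L (b i), by
    rw [mem_ringOfIntegers_iff, spectralValuation_algebraMap]
    exact hb i⟩
  have hroot : ∀ z : nthRootsFinset l (1 : ringOfIntegers l L),
      ((z : ringOfIntegers l L) : L) ^ l = 1 := by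
    intro z
    have := (mem_nthRootsFinset hl.pos 1).1 z.2
    simpa using congrArg Subtype.val this
  let αz : nthRootsFinset l (1 : ringOfIntegers l L) → ringOfIntegers l L := fun z =>
    ⟨α ((z : ringOfIntegers l L) : L), hα _ (hroot z)⟩
  let f : nthRootsFinset l (1 : ringOfIntegers l L) → residueField l L := fun z =>
    residue _ (αz z)
  -- Differences of distinct `l`-th roots of unity are associates of `ζ - 1`, so `α z - α z'` has
  -- absolute value `1`.
  have hinj : Function.Injective f := by
    intro z z' hzz'
    by_contra hne
    have h1 : (αz z - αz z') ∈ maxIdeal l L := by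
      rw [← residue_eq_zero_iff, map_sub, sub_eq_zero]
      exact hzz'
    rw [mem_maxIdeal_iff] at h1
    have hass := hz₀'.nthRootsFinset_pairwise_associated_sub_one_sub_of_prime hl z.2 z'.2
      (fun h => hne (Subtype.ext h))
    have h2 : spectralValuation l L ((z₀ - 1 : ringOfIntegers l L) : L) =
        spectralValuation l L (((z : ringOfIntegers l L) - z' : ringOfIntegers l L) : L) :=
      le_antisymm ((dvd_iff_spectralValuation_le l _ _).1 hass.symm.dvd)
        ((dvd_iff_spectralValuation_le l _ _).1 hass.dvd)
    push_cast at h1 h2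
    rw [hz₀, Valuation.map_sub_swap] at h2
    have h3 : α ((z : ringOfIntegers l L) : L) - α ((z' : ringOfIntegers l L) : L) =
        (((z : ringOfIntegers l L) : L) - ((z' : ringOfIntegers l L) : L)) * ρ /
          (1 - algebraMap K L ζ) := by
      simp only [α]
      ring
    have h4 : spectralValuation l L (α ((z : ringOfIntegers l L) : L) -
        α ((z' : ringOfIntegers l L) : L)) = 1 := by
      rw [h3, map_div₀, map_mul, hρv, mul_one, ← h2]
      exact div_self ((Valuation.ne_zero_iff _).2 hδ0)
    exact h1.ne h4
  let g : (residueField l L)[X] := ∑ j : Fin l, C (residue _ (bL j)) * X ^ (j : ℕ)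
  have hg : g = 0 := by
    refine eq_zero_of_natDegree_lt_card_of_eval_eq_zero g hinj (fun z => ?_) ?_
    · have h1 : spectralValuation l L
          (∑ j, algebraMap K L (b j) * α ((z : ringOfIntegers l L) : L) ^ (j : ℕ)) < 1 := by
        -- The sum is a polynomial over `K` in `ρ`, so replacing `ρ` by its conjugate `zρ` preserves
        -- its absolute value.
        have h2 := spectralValuation_aeval_mul_rootOfUnity hμ hρ (hroot z)
          (∑ j : Fin l, C (b j) * (C (1 - ζ)⁻¹ * (X - 1)) ^ (j : ℕ))
        simp only [map_sum, map_mul, map_pow, map_sub, map_one, aeval_C, aeval_X, map_inv₀] at h2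
        simp only [div_eq_inv_mul, α] at hsum ⊢
        rw [h2]
        exact hsum
      have h3 : (∑ j, bL j * αz z ^ (j : ℕ)) ∈ maxIdeal l L := by
        rw [mem_maxIdeal_iff]
        push_cast
        exact h1
      rw [← residue_eq_zero_iff, map_sum] at h3
      simp only [g, eval_finsetSum, eval_mul, eval_C, eval_pow, eval_X, f]
      simpa using h3
    · rw [Fintype.card_coe, hz₀'.card_nthRootsFinset]
      refine lt_of_le_of_lt (natDegree_sum_le_of_forall_le (n := l - 1) _ _ fun j _ => ?_)
        (Nat.sub_lt hl.pos one_pos)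
      exact (natDegree_C_mul_X_pow_le _ _).trans (by omega)
  have hcoeff : residue _ (bL i) = 0 := by
    have h1 := congrArg (fun q => coeff q (i : ℕ)) hg
    simp only [g, finsetSum_coeff, coeff_C_mul, coeff_X_pow, coeff_zero] at h1
    rw [Finset.sum_eq_single i] at h1
    · simpa using h1
    · intro j _ hj
      rw [if_neg (fun h => hj (Fin.ext h.symm)), mul_zero]
    · intro h
      exact absurd (Finset.mem_univ i) h
  have h1 := (mem_maxIdeal_iff l _).1 ((residue_eq_zero_iff _).1 hcoeff)
  rwa [spectralValuation_algebraMap] at h1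

/-- Dividing by a largest coefficient reduces to the integral case: that coefficient becomes `1`,
which is not small. -/
theorem spectralValuation_coeff_le_sum {ζ : K} (hζ : IsPrimitiveRoot ζ l) {μ : K}
    (hμ : ∀ b : K, b ^ l ≠ μ)
    (hμ1 : spectralValuation l K (1 - μ) ≤ spectralValuation l K (1 - ζ) ^ l) {ρ : L}
    (hρ : ρ ^ l = algebraMap K L μ) (a : Fin l → K) (i : Fin l) :
    spectralValuation l K (a i) ≤ spectralValuation l L
      (∑ j, algebraMap K L (a j) * ((ρ - 1) / (1 - algebraMap K L ζ)) ^ (j : ℕ)) := by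
  have : Nonempty (Fin l) := ⟨i⟩
  obtain ⟨j, -, hj⟩ := Finset.exists_max_image Finset.univ (fun j => spectralValuation l K (a j))
    Finset.univ_nonempty
  refine (hj i (Finset.mem_univ i)).trans ?_
  by_cases hj0 : a j = 0
  · simp [hj0]
  by_contra! hlt
  have hv0 : 0 < spectralValuation l K (a j) := by
    rw [zero_lt_iff, Valuation.ne_zero_iff]
    exact hj0
  have h := spectralValuation_coeff_lt_one hζ hμ hμ1 hρ (b := fun i => (a j)⁻¹ * a i) (fun i => by
    rw [map_mul, map_inv₀, ← div_eq_inv_mul]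
    exact div_le_one_of_le₀ (hj i (Finset.mem_univ i)) zero_le) (by
    simp only [map_mul, mul_assoc]
    rw [← Finset.mul_sum, map_mul, spectralValuation_algebraMap, map_inv₀, ← div_eq_inv_mul]
    exact (div_lt_one₀ hv0).2 hlt) j
  rw [inv_mul_cancel₀ hj0, map_one] at h
  exact lt_irrefl _ h

theorem hasOrthogonalPowers_of_close_to_one {ζ : K} (hζ : IsPrimitiveRoot ζ l) {μ : K}
    (hμ : ∀ b : K, b ^ l ≠ μ)
    (hμ1 : spectralValuation l K (1 - μ) ≤ spectralValuation l K (1 - ζ) ^ l) {ρ : L}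
    (hρ : ρ ^ l = algebraMap K L μ) :
    spectralValuation l L ((ρ - 1) / (1 - algebraMap K L ζ)) = 1 ∧
      HasOrthogonalPowers l K l ((ρ - 1) / (1 - algebraMap K L ζ)) := by
  have hl := (Fact.out : l.Prime)
  have h1 : spectralValuation l L ((ρ - 1) / (1 - algebraMap K L ζ)) = 1 := by
    apply le_antisymm
    · have h2 := spectralValuation_sub_root_pow hζ hμ hρ 1
      rw [one_pow] at h2
      rw [← h2, map_one, Valuation.map_sub_swap] at hμ1
      have h3 := le_of_pow_le_pow_left₀ hl.ne_zero zero_le hμ1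
      rw [map_div₀]
      refine div_le_one_of_le₀ (h3.trans_eq ?_) zero_le
      rw [← spectralValuation_algebraMap l L, map_sub, map_one]
    -- The lower bound is the coefficient estimate for the polynomial `X`, available since `1 < l`.
    · have h2 := spectralValuation_coeff_le_sum hζ hμ hμ1 hρ (Pi.single ⟨1, hl.one_lt⟩ 1)
        ⟨1, hl.one_lt⟩
      rw [Pi.single_eq_same, map_one, Finset.sum_eq_single ⟨1, hl.one_lt⟩] at h2
      · simpa using h2
      · intro j _ hj
        rw [Pi.single_eq_of_ne hj, map_zero, zero_mul]
      · intro h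
        exact absurd (Finset.mem_univ _) h
  refine ⟨h1, fun a i => ?_⟩
  rw [map_mul, map_pow, h1, one_pow, mul_one, spectralValuation_algebraMap]
  exact spectralValuation_coeff_le_sum hζ hμ hμ1 hρ a i

end Unramified

/-! ### The Kummer extension of a line, case by case. -/

section KummerExtension

variable {l : ℕ} [Fact l.Prime] {K : Type*} [Field K] {D : Subgroup (PowerClasses l K)}

theorem exists_pow_eq_algebraMap {μ : Kˣ} (hμ : powerClass l μ ∈ D) :
    ∃ ρ : kummerExtension D, ρ ^ l = algebraMap K (kummerExtension D) μ := by
  obtain ⟨ρ, hρ⟩ := IsAlgClosed.exists_pow_nat_eq (algebraMap K (AlgebraicClosure K) μ)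
    (Fact.out : l.Prime).pos
  exact ⟨⟨ρ, IntermediateField.subset_adjoin _ _ ⟨μ, hμ, hρ⟩⟩, Subtype.ext hρ⟩

/-- An `l`-th root of `μ ^ j c ^ l` is `ρ ^ j c` times a root of unity, which lies in `K`. -/
theorem kummerExtension_eq_adjoin {ζ : K} (hζ : IsPrimitiveRoot ζ l) {μ : Kˣ}
    (hμ : Subgroup.zpowers (powerClass l μ) = D) {ρ : AlgebraicClosure K}
    (hρ : ρ ^ l = algebraMap K (AlgebraicClosure K) μ) :
    kummerExtension D = IntermediateField.adjoin K {ρ} := by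
  have hl := (Fact.out : l.Prime)
  have hζ' : IsPrimitiveRoot (algebraMap K (AlgebraicClosure K) ζ) l :=
    hζ.map_of_injective (algebraMap K (AlgebraicClosure K)).injective
  apply le_antisymm
  · refine IntermediateField.adjoin_le_iff.2 ?_
    rintro x ⟨a, ha, hx⟩
    rw [← hμ] at ha
    obtain ⟨j, hj⟩ := Subgroup.mem_zpowers_iff.1 ha
    obtain ⟨c, rfl⟩ := powerClass_eq_iff.1 (hj.symm.trans (map_zpow (powerClass l) μ j).symm)
    have hρ0 : ρ ≠ 0 := by
      rintro rfl
      rw [zero_pow hl.ne_zero] at hρ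
      exact (_root_.map_ne_zero _).2 μ.ne_zero hρ.symm
    have hy0 : ρ ^ j * algebraMap K (AlgebraicClosure K) c ≠ 0 :=
      mul_ne_zero (zpow_ne_zero _ hρ0) ((_root_.map_ne_zero _).2 c.ne_zero)
    have hpow : x ^ l = (ρ ^ j * algebraMap K (AlgebraicClosure K) c) ^ l := by
      rw [hx, mul_pow, ← zpow_natCast (ρ ^ j), zpow_comm, zpow_natCast, hρ,
        Units.val_mul, Units.val_zpow_eq_zpow_val, Units.val_pow_eq_pow_val, map_mul, map_zpow₀,
        map_pow]
    have hone : (x / (ρ ^ j * algebraMap K (AlgebraicClosure K) c)) ^ l = 1 := by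
      rw [div_pow, hpow, div_self (pow_ne_zero _ hy0)]
    obtain ⟨i, -, hi⟩ := hζ'.eq_pow_of_pow_eq_one hone
    rw [eq_div_iff hy0] at hi
    rw [← hi, SetLike.mem_coe]
    exact mul_mem (pow_mem (IntermediateField.algebraMap_mem _ _) _)
      (mul_mem (zpow_mem (IntermediateField.mem_adjoin_simple_self K ρ) _)
        (IntermediateField.algebraMap_mem _ _))
  · rw [IntermediateField.adjoin_simple_le_iff]
    exact IntermediateField.subset_adjoin _ _ ⟨μ, hμ ▸ Subgroup.mem_zpowers _, hρ⟩

theorem finrank_kummerExtension (hD : IsLine D) {ζ : K} (hζ : IsPrimitiveRoot ζ l) :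
    Module.finrank K (kummerExtension D) = l := by
  have hl := (Fact.out : l.Prime)
  obtain ⟨d, hd, hd1⟩ := hD.exists_ne_one
  obtain ⟨μ, rfl⟩ := QuotientGroup.mk'_surjective _ d
  obtain ⟨ρ, hρ⟩ := IsAlgClosed.exists_pow_nat_eq (algebraMap K (AlgebraicClosure K) μ) hl.pos
  have hirr := X_pow_sub_C_irreducible_of_prime hl (pow_ne_of_powerClass_ne_one hd1)
  have hmin : X ^ l - C (μ : K) = minpoly K ρ :=
    minpoly.eq_of_irreducible_of_monic hirr (by simp [hρ]) (monic_X_pow_sub_C _ hl.ne_zero)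
  rw [kummerExtension_eq_adjoin hζ (hD.zpowers_eq hd hd1) hρ,
    IntermediateField.adjoin.finrank (Algebra.IsIntegral.isIntegral ρ), ← hmin,
    natDegree_X_pow_sub_C]

theorem finiteDimensional_kummerExtension [Algebra ℚ_[l] K] [FiniteDimensional ℚ_[l] K]
    (hD : IsLine D) {ζ : K} (hζ : IsPrimitiveRoot ζ l) :
    FiniteDimensional ℚ_[l] (kummerExtension D) := by
  have : FiniteDimensional K (kummerExtension D) := FiniteDimensional.of_finrank_pos (by
    rw [finrank_kummerExtension hD hζ]
    exact (Fact.out : l.Prime).pos)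
  exact Module.Finite.trans K _

variable [Algebra ℚ_[l] K] [FiniteDimensional ℚ_[l] K]

theorem IsUniformiser.powerClass_ne_one {μ : Kˣ} (hμ : IsUniformiser l K μ) :
    powerClass l μ ≠ 1 := by
  intro h
  obtain ⟨c, hc⟩ := powerClass_eq_one_iff.1 h
  obtain ⟨π, hπ, hirr⟩ := hμ.exists_irreducible
  have hc1 : spectralValuation l K (c : K) ≤ 1 := by
    have h1 := spectralValuation_coe_le_one l π
    rw [hπ, ← hc] at h1
    push_cast at h1
    rw [map_pow] at h1
    exact (pow_le_one_iff (Fact.out : l.Prime).ne_zero).1 h1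
  have hπ' : π = (⟨c, (mem_ringOfIntegers_iff l _).2 hc1⟩ : ringOfIntegers l K) ^ l := by
    ext
    push_cast
    rw [hπ, ← hc]
    push_cast
    rfl
  rw [hπ'] at hirr
  exact not_irreducible_pow (Fact.out : l.Prime).ne_one hirr

theorem kummerExtension_of_isUniformiser (hD : IsLine D) {ζ : K} (hζ : IsPrimitiveRoot ζ l)
    {μ : Kˣ} (hμ : IsUniformiser l K μ) {ρ : kummerExtension D}
    (hρ : ρ ^ l = algebraMap K (kummerExtension D) μ) :
    IsUniformiser l (kummerExtension D) ρ ∧ IsIntegralGenerator l K (kummerExtension D) ρ := by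
  have := finiteDimensional_kummerExtension hD hζ
  obtain ⟨π, hπ, hirr⟩ := hμ.exists_irreducible
  refine isUniformiser_and_isIntegralGenerator_of_pow_eq hirr (finrank_kummerExtension hD hζ)
    (Fact.out : l.Prime).ne_zero ?_
  rw [← map_pow, hρ, spectralValuation_algebraMap, hπ]

/-- The norm identity gives `|ξ - ρ| ^ l = |π| ^ m`, so the `l`-th power of the value of the product
is `|π| ^ (m x + l y) = |π|`. -/
theorem kummerExtension_of_normVal_eq (hD : IsLine D) {ζ : K} (hζ : IsPrimitiveRoot ζ l)
    {μ : (ringOfIntegers l K)ˣ} (hμ : Subgroup.zpowers (powerClass l (unitToField l K μ)) = D)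
    {m : ℕ} {ξ : (ringOfIntegers l K)ˣ}
    (hξ : normVal l K ((ξ : ringOfIntegers l K) ^ l - (μ : ringOfIntegers l K)) = m)
    {ρ : kummerExtension D}
    (hρ : ρ ^ l = algebraMap K (kummerExtension D) (unitToField l K μ : Kˣ))
    {lam : K} (hlam : IsUniformiser l K lam) {x y : ℤ} (hxy : m * x + l * y = 1) :
    IsUniformiser l (kummerExtension D)
        ((algebraMap K (kummerExtension D) (unitToField l K ξ : Kˣ) - ρ) ^ x *
          algebraMap K (kummerExtension D) lam ^ y) ∧
      IsIntegralGenerator l K (kummerExtension D)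
        ((algebraMap K (kummerExtension D) (unitToField l K ξ : Kˣ) - ρ) ^ x *
          algebraMap K (kummerExtension D) lam ^ y) := by
  have := finiteDimensional_kummerExtension hD hζ
  obtain ⟨π, rfl, hπ⟩ := hlam.exists_irreducible
  refine isUniformiser_and_isIntegralGenerator_of_pow_eq hπ (finrank_kummerExtension hD hζ)
    (Fact.out : l.Prime).ne_zero ?_
  have h1 := spectralValuation_sub_root_pow hζ (pow_ne_of_powerClass_ne_one (hD.ne_one hμ)) hρ
    (unitToField l K ξ : Kˣ)
  have h2 := (normVal_eq_iff hπ m _).1 hξ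
  push_cast at h2
  rw [coe_unitToField, coe_unitToField, h2] at h1
  have hq := (spectralValuation_irreducible_pos hπ).ne'
  rw [map_mul, mul_pow, map_zpow₀, map_zpow₀, spectralValuation_algebraMap, ← zpow_natCast,
    ← zpow_natCast, zpow_comm, zpow_natCast, coe_unitToField, h1, ← zpow_natCast, ← zpow_mul,
    ← zpow_mul, ← zpow_add₀ hq, mul_comm y, hxy, zpow_one]

/-- If `m = l s`, the case `s = 0` contradicts `Ū_0 = Ū_1`, and `s > 0` contradicts the absence of a
jump at `l s`. -/
theorem coprime_of_powerClass_notMem {ζ : K} (hζ : IsPrimitiveRoot ζ l)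
    {μ : (ringOfIntegers l K)ˣ} {m : ℕ} (hm : m < l * ramOne l K)
    (h1 : powerClass l (unitToField l K μ) ∈ classFiltration l K m)
    (h2 : powerClass l (unitToField l K μ) ∉ classFiltration l K (m + 1)) : m.Coprime l := by
  have hl := (Fact.out : l.Prime)
  refine ((Nat.Prime.coprime_iff_not_dvd hl).2 ?_).symm
  rintro ⟨s, rfl⟩
  rcases Nat.eq_zero_or_pos s with rfl | hs
  · exact h2 (powerClass_unit_mem_classFiltration_one μ)
  · exact h2 (powerClass_mem_classFiltration_succ hζ hs (Nat.lt_of_mul_lt_mul_left hm) h1)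

/-- Any unit whose `l`-th power approximates `μ` modulo `𝔭 ^ m` works: by discreteness, a better
approximation would put the class in the next level. -/
theorem exists_normVal_pow_sub_eq {μ : (ringOfIntegers l K)ˣ} {m : ℕ}
    (h1 : powerClass l (unitToField l K μ) ∈ classFiltration l K m)
    (h2 : powerClass l (unitToField l K μ) ∉ classFiltration l K (m + 1)) :
    ∃ ξ : (ringOfIntegers l K)ˣ,
      normVal l K ((ξ : ringOfIntegers l K) ^ l - (μ : ringOfIntegers l K)) = m := by
  obtain ⟨π, hπ⟩ := IsDiscreteValuationRing.exists_irreducible (ringOfIntegers l K)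
  rw [powerClass_mem_classFiltration_iff hπ] at h1 h2
  obtain ⟨w, hw⟩ := h1
  refine ⟨w, (normVal_eq_iff hπ m _).2 ?_⟩
  push_cast
  rw [Valuation.map_sub_swap]
  by_contra hne
  exact h2 ⟨w, spectralValuation_le_pow_succ hπ (lt_of_le_of_ne hw hne)⟩

theorem kummerExtension_of_eq_one_sub_mul (hD : IsLine D) {ζ : K} (hζ : IsPrimitiveRoot ζ l)
    {η : ringOfIntegers l K} {μ : (ringOfIntegers l K)ˣ}
    (hμ : Subgroup.zpowers (powerClass l (unitToField l K μ)) = D)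
    (hη : (unitToField l K μ : K) = 1 - η * l * (1 - ζ)) {ρ : kummerExtension D}
    (hρ : ρ ^ l = algebraMap K (kummerExtension D) (unitToField l K μ : Kˣ)) :
    (∀ lam : K, IsUniformiser l K lam →
        IsUniformiser l (kummerExtension D) (algebraMap K (kummerExtension D) lam)) ∧
      IsIntegralGenerator l K (kummerExtension D)
        ((ρ - 1) / (1 - algebraMap K (kummerExtension D) ζ)) := by
  have := finiteDimensional_kummerExtension hD hζ
  have h1 : spectralValuation l K (1 - (unitToField l K μ : K)) ≤
      spectralValuation l K (1 - ζ) ^ l := by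
    obtain ⟨π, hπ⟩ := IsDiscreteValuationRing.exists_irreducible (ringOfIntegers l K)
    rw [hη, Valuation.map_sub_swap, spectralValuation_one_sub_primitiveRoot hζ hπ, ← pow_mul,
      mul_comm _ l]
    exact spectralValuation_one_sub_mul_sub_one_le hζ hπ η
  have h2 := hasOrthogonalPowers_of_close_to_one hζ
    (pow_ne_of_powerClass_ne_one (hD.ne_one hμ)) h1 hρ
  exact isUniformiser_and_isIntegralGenerator_of_eq_one (finrank_kummerExtension hD hζ) h2.1 h2.2

theorem exists_isIntegralGenerator_kummerExtension (hD : IsLine D) {ζ : K}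
    (hζ : IsPrimitiveRoot ζ l) :
    ∃ α : kummerExtension D, IsIntegralGenerator l K (kummerExtension D) α := by
  obtain ⟨d, hd, hd1⟩ := hD.exists_ne_one
  rcases hD.trichotomy hζ with h | ⟨h, m, hm, hm1, hm2⟩ | h
  · obtain ⟨μ, hμ, hμD⟩ := exists_isUniformiser_powerClass_mem h
    obtain ⟨ρ, hρ⟩ := exists_pow_eq_algebraMap hμD
    exact ⟨ρ, (kummerExtension_of_isUniformiser hD hζ hμ hρ).2⟩
  · obtain ⟨μ, rfl⟩ := exists_unit_of_mem_classFiltration_one (h hd)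
    have hμ := hD.zpowers_eq hd hd1
    have hnot : powerClass l (unitToField l K μ) ∉ classFiltration l K (m + 1) := by
      intro h'
      rw [← hμ, Subgroup.zpowers_le] at hm2
      exact hm2 h'
    obtain ⟨ρ, hρ⟩ := exists_pow_eq_algebraMap hd
    obtain ⟨ξ, hξ⟩ := exists_normVal_pow_sub_eq (hm1 hd) hnot
    obtain ⟨π, hπ⟩ := IsDiscreteValuationRing.exists_irreducible (ringOfIntegers l K)
    obtain ⟨x, y, hxy⟩ := Nat.isCoprime_iff_coprime.2
      (coprime_of_powerClass_notMem hζ hm (hm1 hd) hnot)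
    exact ⟨_, (kummerExtension_of_normVal_eq hD hζ hμ hξ hρ ((isUniformiser_iff hπ).2 rfl)
      (x := x) (y := y) (by rw [← hxy]; ring)).2⟩
  · obtain ⟨c, hc⟩ := exists_generatesArtinSchreier l (residueField l K)
    obtain ⟨η, rfl⟩ := residue_surjective c
    obtain ⟨μ, hμ⟩ := exists_unit_eq_one_sub_mul hζ η
    have hμD := (h.trans (classFiltration_eq_zpowers hζ hc hμ)).symm
    obtain ⟨ρ, hρ⟩ := exists_pow_eq_algebraMap (D := D) (hμD ▸ Subgroup.mem_zpowers _)
    exact ⟨_, (kummerExtension_of_eq_one_sub_mul hD hζ hμD hμ hρ).2⟩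

end KummerExtension

end

end LocalKummer

theorem corollary61 (l : ℕ) [Fact l.Prime]
    (K : Type*) [Field K] [Algebra ℚ_[l] K] [FiniteDimensional ℚ_[l] K]
    (ζ : K) (hζ : IsPrimitiveRoot ζ l)
    (D : Subgroup (PowerClasses l K)) (hD : IsLine D) :
    -- the three cases below exhaust all lines
    (¬ D ≤ classFiltration l K 1 ∨
      (D ≤ classFiltration l K 1 ∧
        ∃ m < l * ramOne l K, D ≤ classFiltration l K m ∧ ¬ D ≤ classFiltration l K (m + 1)) ∨
      D = classFiltration l K (l * ramOne l K)) ∧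
    -- the ring of integers is monogenic
    (∃ α : kummerExtension D, IsIntegralGenerator l K (kummerExtension D) α) ∧
    -- first case: `D` is not contained in `Ū_1`
    (¬ D ≤ classFiltration l K 1 →
      (∃ μ : Kˣ, IsUniformiser l K μ ∧ powerClass l μ ∈ D) ∧
      ∀ μ : Kˣ, IsUniformiser l K μ → powerClass l μ ∈ D →
        ∀ ρ : kummerExtension D, ρ ^ l = algebraMap K (kummerExtension D) μ →
          IsUniformiser l (kummerExtension D) ρ ∧
          IsIntegralGenerator l K (kummerExtension D) ρ) ∧
    -- second case: `D` is contained in `Ū_1`, of level `m < l e₁`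
    (D ≤ classFiltration l K 1 →
      ∀ μ : (ringOfIntegers l K)ˣ,
        Subgroup.zpowers (powerClass l (unitToField l K μ)) = D →
        ∀ m : ℕ, m < l * ramOne l K →
          powerClass l (unitToField l K μ) ∈ classFiltration l K m →
          powerClass l (unitToField l K μ) ∉ classFiltration l K (m + 1) →
          m.Coprime l ∧
          (∃ ξ : (ringOfIntegers l K)ˣ,
            normVal l K ((ξ : ringOfIntegers l K) ^ l - (μ : ringOfIntegers l K)) = m) ∧
          ∀ ξ : (ringOfIntegers l K)ˣ,
            normVal l K ((ξ : ringOfIntegers l K) ^ l - (μ : ringOfIntegers l K)) = m →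
            ∀ ρ : kummerExtension D,
              ρ ^ l = algebraMap K (kummerExtension D) (unitToField l K μ : Kˣ) →
              ∀ lam : K, IsUniformiser l K lam →
                ∀ x y : ℤ, m * x + l * y = 1 →
                  IsUniformiser l (kummerExtension D)
                    ((algebraMap K (kummerExtension D) (unitToField l K ξ : Kˣ) - ρ) ^ x *
                      algebraMap K (kummerExtension D) lam ^ y) ∧
                  IsIntegralGenerator l K (kummerExtension D)
                    ((algebraMap K (kummerExtension D) (unitToField l K ξ : Kˣ) - ρ) ^ x *
                      algebraMap K (kummerExtension D) lam ^ y)) ∧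
    -- third case: `D = Ū_{l e₁}`
    (D = classFiltration l K (l * ramOne l K) →
      (∀ lam : K, IsUniformiser l K lam →
        IsUniformiser l (kummerExtension D) (algebraMap K (kummerExtension D) lam)) ∧
      ∀ η : ringOfIntegers l K,
        GeneratesArtinSchreier l (residueField l K) (IsLocalRing.residue _ η) →
        ∃ μ : (ringOfIntegers l K)ˣ,
          (unitToField l K μ : K) = 1 - (η : K) * l * (1 - ζ) ∧
          Subgroup.zpowers (powerClass l (unitToField l K μ)) = D ∧
          ∀ ρ : kummerExtension D,
            ρ ^ l = algebraMap K (kummerExtension D) (unitToField l K μ : Kˣ) →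
            IsIntegralGenerator l K (kummerExtension D)
              ((ρ - 1) / (1 - algebraMap K (kummerExtension D) ζ))) := by
  refine ⟨hD.trichotomy hζ, exists_isIntegralGenerator_kummerExtension hD hζ, ?_, ?_, ?_⟩
  · intro h
    exact ⟨exists_isUniformiser_powerClass_mem h, fun μ hμ _ ρ hρ =>
      kummerExtension_of_isUniformiser hD hζ hμ hρ⟩
  · intro _ μ hμ m hm hm1 hm2
    exact ⟨coprime_of_powerClass_notMem hζ hm hm1 hm2, exists_normVal_pow_sub_eq hm1 hm2,
      fun ξ hξ ρ hρ lam hlam x y hxy =>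
        kummerExtension_of_normVal_eq hD hζ hμ hξ hρ hlam hxy⟩
  · intro h
    have key : ∀ η : ringOfIntegers l K,
        GeneratesArtinSchreier l (residueField l K) (IsLocalRing.residue _ η) →
        ∃ μ : (ringOfIntegers l K)ˣ, (unitToField l K μ : K) = 1 - (η : K) * l * (1 - ζ) ∧
          Subgroup.zpowers (powerClass l (unitToField l K μ)) = D := by
      intro η hη
      obtain ⟨μ, hμ⟩ := exists_unit_eq_one_sub_mul hζ η
      exact ⟨μ, hμ, (h.trans (classFiltration_eq_zpowers hζ hη hμ)).symm⟩
    constructor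
    -- The claim about uniformisers does not mention `η`, so some generator of `k / ℘(k)` is chosen
    -- to describe the extension.
    · obtain ⟨c, hc⟩ := exists_generatesArtinSchreier l (residueField l K)
      obtain ⟨η, rfl⟩ := IsLocalRing.residue_surjective c
      obtain ⟨μ, hμ, hμD⟩ := key η hc
      obtain ⟨ρ, hρ⟩ := exists_pow_eq_algebraMap (D := D) (hμD ▸ Subgroup.mem_zpowers _)
      exact (kummerExtension_of_eq_one_sub_mul hD hζ hμD hμ hρ).1
    · intro η hη
      obtain ⟨μ, hμ, hμD⟩ := key η hη
      exact ⟨μ, hμ, hμD, fun ρ hρ => (kummerExtension_of_eq_one_sub_mul hD hζ hμD hμ hρ).2⟩
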